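/- Let $X=\{(X_t)_{t\ge 0},(\mathbb P_i)_{i\in S}\}$ be an irreducible, non-explosive, time-homogeneous continuous time Markov chain with right-continuous paths on a finite or countable (discrete) state space $S$, with transition probabilities $p_{ij}(t)=\mathbb P_i(X_t=j)$, whose $q$-matrix $q_{ij}=p_{ij}'(0)$ exists, is finite, and is conservative, that is, $\sum_{j\in S}q_{ij}=0$ for all $i\in S$. Let $D\subset S$, $E=S\setminus D$, and $T=\inf\{t\ge 0: X_t\in D\}$ (with $\inf\emptyset=\infty$). Let $\Delta$ be a cemetery point, $E_\Delta=E\cup\{\Delta\}$, and let $X^T$ be the killed chain, $X^T_t=X_t$ if $t<T$ and $X^T_t=\Delta$ if $t\ge T$, with transition probabilities $P^T(t)=(p^T_{ij}(t))_{i,j\in E_\Delta}$ given by $p^T_{ij}(t)=\mathbb P_i(X_t=j,\,t<T)$ for $i,j\in E$, $p^T_{i\Delta}(t)=\mathbb P_i(t\ge T)$ for $i\in E$, and $p^T_{\Delta j}(t)=1_{\{j=\Delta\}}$. Let $\mu=(\mu_i)_{i\in E_\Delta}$ be a probability distribution on $E_\Delta$ with $\mu_\Delta=0$, let $\mathbb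 P_\mu=\sum_{i\in E}\mu_i\mathbb P_i$, and suppose that $\mu$ is quasi-stationary, that is, $$\mathbb P_\mu(X^T_t=i\mid T>t)=\mu_i\qquad\text{for all } t\ge 0,\ i\in E_\Delta .$$ Then $\mu P^T(t)$ is differentiable and $\frac{d}{dt}\,\mu P^T(t)=\mu\,\frac{d}{dt}P^T(t)$ for all $t>0$. Explicitly, for all $t>0$ and $j\in E_\Delta$, the functions $p^T_{ij}$, $i\in E_\Delta$, are differentiable at $t$, the series $\sum_{i\in E_\Delta}\mu_i\,\frac{d}{dt}p^T_{ij}(t)$ converges absolutely, the function $s\mapsto\sum_{i\in E_\Delta}\mu_i\,p^T_{ij}(s)$ is differentiable at $t$, and $$\frac{d}{dt}\sum_{i\in E_\Delta}\mu_i\,p^T_{ij}(t)=\sum_{i\in E_\Delta}\mu_i\,\frac{d}{dt}p^T_{ij}(t).$$ -/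

import Mathlib

open MeasureTheory Filter Topology Set
open scoped NNReal ENNReal

/-- A time-homogeneous continuous time Markov chain `{(X_t)_{t ≥ 0}, (ℙ_i)_{i ∈ S}}` with discrete
state space `S`: a family of probability laws `ℙ_i` on a common sample space, and a process with
right-continuous paths (for the discrete topology of `S`) that starts at `i` under `ℙ_i` and
satisfies the Markov property. -/
structure CTMarkovChain (S Ω : Type*) [MeasurableSpace Ω] where
  /-- the process -/
  X : ℝ≥0 → Ω → S
  /-- the law `ℙ_i` of the chain started at `i` -/
  P : S → Measure Ω
  isProbabilityMeasure : ∀ i, IsProbabilityMeasure (P i)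
  measurableSet_eq : ∀ t j, MeasurableSet {ω | X t ω = j}
  start : ∀ i, P i {ω | X 0 ω = i} = 1
  rightCont : ∀ ω t, ∀ᶠ s in 𝓝[>] t, X s ω = X t ω
  /-- Markov property: the past is given by the values `x s` at finitely many times `s ∈ F`,
  all of them at most `t`, the present is `X_t = j`, and the future is `X_{t+h} = k`. -/
  markov : ∀ (i : S) (F : Finset ℝ≥0) (x : ℝ≥0 → S) (t h : ℝ≥0) (j k : S),
    (∀ s ∈ F, s ≤ t) →
      P i {ω | (∀ s ∈ F, X s ω = x s) ∧ X t ω = j ∧ X (t + h) ω = k} =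
        P i {ω | (∀ s ∈ F, X s ω = x s) ∧ X t ω = j} * P j {ω | X h ω = k}

namespace CTMarkovChain

variable {S Ω : Type*} [MeasurableSpace Ω]

/-- The transition probabilities `p_{ij}(t) = ℙ_i(X_t = j)`. -/
noncomputable def p (M : CTMarkovChain S Ω) (t : ℝ≥0) (i j : S) : ℝ :=
  (M.P i).real {ω | M.X t ω = j}

/-- `X` is irreducible: every state is reached from every other one with positive probability. -/
def Irreducible (M : CTMarkovChain S Ω) : Prop :=
  ∀ i j, ∃ t : ℝ≥0, 0 < t ∧ 0 < M.p t i j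

/-- All the (right) derivatives `p_{ij}'(0)` exist and are finite. -/
def HasQMatrix (M : CTMarkovChain S Ω) : Prop :=
  ∀ i j, DifferentiableWithinAt ℝ (fun t : ℝ => M.p t.toNNReal i j) (Ici 0) 0

/-- The `q`-matrix `q_{ij} = p_{ij}'(0)`. -/
noncomputable def q (M : CTMarkovChain S Ω) (i j : S) : ℝ :=
  derivWithin (fun t : ℝ => M.p t.toNNReal i j) (Ici 0) 0

/-- The `q`-matrix is conservative: it exists and each of its rows sums to zero. -/
def Conservative (M : CTMarkovChain S Ω) : Prop :=
  M.HasQMatrix ∧ ∀ i, HasSum (fun j => M.q i j) 0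

/-- `X` is not explosive: almost surely, there are finitely many jumps in each bounded time
interval. (The paths being right-continuous, `s` is a jump time if `X` is not equal to `X_s`
immediately before `s`.) -/
def NonExplosive (M : CTMarkovChain S Ω) : Prop :=
  ∀ i, ∀ᵐ ω ∂(M.P i), ∀ t : ℝ≥0,
    {s : ℝ≥0 | s ≤ t ∧ ¬ ∀ᶠ r in 𝓝[<] s, M.X r ω = M.X s ω}.Finite

/-- The first passage time `T = inf {t ≥ 0 : X_t ∈ D}`, with value `∞` if `X` never visits `D`. -/
noncomputable def T (M : CTMarkovChain S Ω) (D : Set S) (ω : Ω) : ℝ≥0∞ :=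
  sInf ((fun t : ℝ≥0 => (t : ℝ≥0∞)) '' {t | M.X t ω ∈ D})

theorem mem_compl_of_lt_T (M : CTMarkovChain S Ω) (D : Set S) {t : ℝ≥0} {ω : Ω}
    (h : (t : ℝ≥0∞) < M.T D ω) : M.X t ω ∈ Dᶜ :=
  fun hD => not_le_of_gt h (sInf_le ⟨t, hD, rfl⟩)

open Classical in
/-- The process killed at time `T`, with values in `E_Δ = E ∪ {Δ}`, where `E = S \ D` and the
cemetery point `Δ` is `none`. -/
noncomputable def killed (M : CTMarkovChain S Ω) (D : Set S) (t : ℝ≥0) (ω : Ω) :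
    Option ↥Dᶜ :=
  if h : (t : ℝ≥0∞) < M.T D ω then some ⟨M.X t ω, M.mem_compl_of_lt_T D h⟩ else none

open Classical in
/-- The transition probabilities `p^T_{ij}(t)`, `i, j ∈ E_Δ`, of the killed process; the cemetery
point is absorbing. -/
noncomputable def pT (M : CTMarkovChain S Ω) (D : Set S) (t : ℝ≥0) :
    Option ↥Dᶜ → Option ↥Dᶜ → ℝ
  | some i, j => (M.P i).real {ω | M.killed D t ω = j}
  | none, j => if j = none then 1 else 0

/-- The law `ℙ_μ = ∑_{i ∈ E} μ_i ℙ_i` for an initial distribution `μ` on `E_Δ` that does not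
charge `Δ`. -/
noncomputable def Pμ (M : CTMarkovChain S Ω) (D : Set S) (μ : PMF (Option ↥Dᶜ)) : Measure Ω :=
  Measure.sum fun i : ↥Dᶜ => μ (some i) • M.P i

/-- `μ` (a distribution on `E_Δ` not charging `Δ`) is quasi-stationary:
`ℙ_μ(X^T_t = i | T > t) = μ_i` for all `t ≥ 0` and `i ∈ E_Δ`. -/
def IsQuasiStationary (M : CTMarkovChain S Ω) (D : Set S) (μ : PMF (Option ↥Dᶜ)) : Prop :=
  μ none = 0 ∧ ∀ (t : ℝ≥0) (i : Option ↥Dᶜ),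
    ProbabilityTheory.cond (M.Pμ D μ) {ω | (t : ℝ≥0∞) < M.T D ω} {ω | M.killed D t ω = i} = μ i

/-- The row vector `μ P^T(t)`. -/
noncomputable def μPT (M : CTMarkovChain S Ω) (D : Set S) (μ : PMF (Option ↥Dᶜ)) (t : ℝ≥0)
    (j : Option ↥Dᶜ) : ℝ :=
  ∑' i, (μ i).toReal * M.pT D t i j

/-- The differentiability condition: `μ P^T(t)` is differentiable and
`d/dt (μ P^T(t)) = μ (d/dt P^T(t))` for all `t > 0`, entry by entry. The existence of the
derivatives of the entries of `P^T` and the (absolute) convergence of the series defining the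
entries of the right-hand side are part of the condition. -/
def DiffCondition (M : CTMarkovChain S Ω) (D : Set S) (μ : PMF (Option ↥Dᶜ)) : Prop :=
  ∀ (t : ℝ), 0 < t → ∀ j : Option ↥Dᶜ,
    (∀ i, DifferentiableAt ℝ (fun s : ℝ => M.pT D s.toNNReal i j) t) ∧
    Summable (fun i => (μ i).toReal * deriv (fun s : ℝ => M.pT D s.toNNReal i j) t) ∧
    HasDerivAt (fun s : ℝ => M.μPT D μ s.toNNReal j)
      (∑' i, (μ i).toReal * deriv (fun s : ℝ => M.pT D s.toNNReal i j) t) t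

end CTMarkovChain

/-! Write `a t` for `ℙ_μ(t < T)`. Quasi-stationarity says that `μ P^T(t)` is `a t * μ` on `E` and `1
- a t` at `Δ`. By the Markov property `a` is multiplicative. It is also continuous, so it is
differentiable with `a' = c * a` (`exists_hasDerivAt_surv`), and the derivative of `μ P^T` is
explicit.

The derivatives of the entries are controlled only by `-q_ii`, which need not be `μ`-summable, so
domination does not give termwise differentiation. Monotonicity replaces it: every entry of column
`j` becomes nondecreasing after multiplication by `exp (-q_jj t)`, and column `Δ` is nondecreasing
as it stands. Partial sums of derivatives are then bounded by the derivative of the sum at every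
time, and Fubini's theorem on monotone series gives equality at almost every time. Equality at some
`s < t` is carried to `t` by Chapman–Kolmogorov over `t - s` and the subinvariance `a(r) μ ≤ μ
P^T(r)` (`hasSum_deriv_of_subinvariant`).

The entries are differentiable by the backward equation (`differentiableAt_of_hasSum_kT`). The
killed chain has the rates `q_ij` at time zero: dyadic skeletons bound its transition probabilities
from below and `p_ij` from above. Conservativity allows the limit inside the sum, and the resulting
right derivative is continuous. -/

theorem HasSum.of_forall_eq {ι : Type*} {f g : ι → ℝ} {x : ℝ} (h : HasSum f x)
    (e : ∀ i, f i = g i) : HasSum g x :=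
  (funext e : f = g) ▸ h

/-! ### Limits of sums and exponential functions. -/

/-- A one-sided Fatou lemma for sums of nonnegative terms. -/
theorem eventually_lt_tsum_of_tendsto {α κ : Type*} {l : Filter α} {a : α → κ → ℝ} {A : κ → ℝ}
    (ha : ∀ᶠ h in l, ∀ k, 0 ≤ a h k) (has : ∀ᶠ h in l, Summable (a h))
    (haA : ∀ k, Tendsto (fun h => a h k) l (𝓝 (A k))) (hA : Summable A) {r : ℝ}
    (hr : r < ∑' k, A k) : ∀ᶠ h in l, r < ∑' k, a h k := by
  obtain ⟨F, hF⟩ := ((tendsto_order.1 hA.hasSum).1 r hr).exists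
  have h1 : Tendsto (fun h => ∑ k ∈ F, a h k) l (𝓝 (∑ k ∈ F, A k)) :=
    tendsto_finsetSum F fun k _ => haA k
  filter_upwards [ha, has, (tendsto_order.1 h1).1 r hF] with h h2 h3 h4
  exact h4.trans_le (h3.sum_le_tsum F fun k _ => h2 k)

/-- Dominated convergence for sums, with a dominating sequence whose sums converge. -/
theorem tendsto_tsum_of_le_of_tendsto_tsum {α κ : Type*} {l : Filter α} [l.NeBot]
    {a b : α → κ → ℝ} {A B : κ → ℝ}
    (ha : ∀ᶠ h in l, ∀ k, 0 ≤ a h k) (hab : ∀ᶠ h in l, ∀ k, a h k ≤ b h k)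
    (hbs : ∀ᶠ h in l, Summable (b h)) (haA : ∀ k, Tendsto (fun h => a h k) l (𝓝 (A k)))
    (hbB : ∀ k, Tendsto (fun h => b h k) l (𝓝 (B k))) (hB : Summable B)
    (hsum : Tendsto (fun h => ∑' k, b h k) l (𝓝 (∑' k, B k))) :
    Tendsto (fun h => ∑' k, a h k) l (𝓝 (∑' k, A k)) := by
  have hA0 : ∀ k, 0 ≤ A k := fun k => ge_of_tendsto (haA k) (ha.mono fun h H => H k)
  have hAB : ∀ k, A k ≤ B k := fun k =>
    le_of_tendsto_of_tendsto (haA k) (hbB k) (hab.mono fun h H => H k)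
  have hA : Summable A := Summable.of_nonneg_of_le hA0 hAB hB
  have has : ∀ᶠ h in l, Summable (a h) := by
    filter_upwards [ha, hab, hbs] with h h1 h2 h3 using Summable.of_nonneg_of_le h1 h2 h3
  refine tendsto_order.2 ⟨fun r hr => eventually_lt_tsum_of_tendsto ha has haA hA hr,
    fun r hr => ?_⟩
  set ε := (r - ∑' k, A k) / 2 with hε
  have hε0 : 0 < ε := by rw [hε]; linarith
  -- Fatou for `b - a`, together with convergence of the sums of `b`, bounds the sums of `a` from
  -- above.
  have h1 := eventually_lt_tsum_of_tendsto (l := l) (a := fun h k => b h k - a h k)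
    (A := fun k => B k - A k) (r := ∑' k, (B k - A k) - ε)
    (hab.mono fun h H k => sub_nonneg.2 (H k))
    (by filter_upwards [has, hbs] with h h1 h2 using h2.sub h1)
    (fun k => (hbB k).sub (haA k)) (hB.sub hA) (by linarith)
  have h2 := (tendsto_order.1 hsum).2 (∑' k, B k + ε) (by linarith)
  filter_upwards [h1, h2, has, hbs] with h h1 h2 h3 h4
  rw [hB.tsum_sub hA, h4.tsum_sub h3] at h1
  linarith

/-- The limit `(1 + x_n / n) ^ n → exp x` along powers of two. With `f = p_ii` it evaluates the
probability of taking only steps from `i` to `i` on ever finer dyadic grids. -/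
theorem tendsto_pow_two_pow_exp {f : ℝ → ℝ} {f' h : ℝ}
    (hf : HasDerivWithinAt f f' (Ici 0) 0) (h0 : f 0 = 1) (hh : 0 < h) :
    Tendsto (fun n : ℕ => f (h / 2 ^ n) ^ (2 ^ n)) atTop (𝓝 (Real.exp (f' * h))) := by
  have h1 : Tendsto (fun n : ℕ => h / (n : ℝ)) atTop (𝓝[Ici 0 \ {0}] 0) := by
    refine tendsto_nhdsWithin_iff.2 ⟨tendsto_const_div_atTop_nhds_zero_nat h, ?_⟩
    filter_upwards [eventually_gt_atTop 0] with n hn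
    have : 0 < h / (n : ℝ) := by positivity
    exact ⟨this.le, this.ne'⟩
  have h2 := (hasDerivWithinAt_iff_tendsto_slope.1 hf).comp h1
  have h3 : Tendsto (fun n : ℕ => (n : ℝ) * (f (h / n) - 1)) atTop (𝓝 (f' * h)) := by
    refine (h2.mul_const h).congr' ?_
    filter_upwards [eventually_gt_atTop 0] with n hn
    have : (n : ℝ) ≠ 0 := by positivity
    simp only [Function.comp, slope_def_field, h0, sub_zero]
    field_simp
  have h4 := Real.tendsto_one_add_pow_exp_of_tendsto h3
  have h5 := h4.comp (tendsto_pow_atTop_atTop_of_one_lt (one_lt_two : (1 : ℕ) < 2))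
  refine h5.congr fun n => ?_
  simp

/-- A positive continuous function which is multiplicative on `[0, ∞)` is differentiable. -/
theorem exists_hasDerivAt_of_mul {a : ℝ → ℝ} (ha : Continuous a) (hpos : ∀ t, 0 < a t)
    (hmul : ∀ t s, 0 ≤ t → 0 ≤ s → a (t + s) = a t * a s) :
    ∃ c, ∀ t, 0 < t → HasDerivAt a (c * a t) t := by
  -- Integrating the functional equation in `s` over `[0, 1]` gives `C * a t = ∫ x in t..t+1, a x`,
  -- whose right side is differentiable because `a` is continuous.
  set C := ∫ x in (0 : ℝ)..1, a x with hC
  have hC0 : 0 < C := intervalIntegral.intervalIntegral_pos_of_pos_on (ha.intervalIntegrable _ _)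
    (fun x _ => hpos x) one_pos
  have key : ∀ t, 0 ≤ t → a t = ((∫ x in (0 : ℝ)..(t + 1), a x) - ∫ x in (0 : ℝ)..t, a x) / C := by
    intro t ht
    rw [intervalIntegral.integral_interval_sub_left (ha.intervalIntegrable _ _)
      (ha.intervalIntegrable _ _), eq_div_iff hC0.ne', hC, ← intervalIntegral.integral_const_mul]
    have : ∫ x in (0 : ℝ)..1, a t * a x = ∫ x in (0 : ℝ)..1, a (t + x) := by
      refine intervalIntegral.integral_congr fun x hx => ?_
      rw [uIcc_of_le zero_le_one] at hx
      exact (hmul t x ht hx.1).symm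
    rw [this, intervalIntegral.integral_comp_add_left a t, add_zero]
  refine ⟨(a 1 - 1) / C, fun t ht => ?_⟩
  have d1 : ∀ u, HasDerivAt (fun t => ∫ x in (0 : ℝ)..t, a x) (a u) u := fun u =>
    intervalIntegral.integral_hasDerivAt_right (ha.intervalIntegrable _ _)
      (ha.stronglyMeasurableAtFilter _ _) ha.continuousAt
  have d2 := (((d1 (t + 1)).comp_add_const t 1).sub (d1 t)).div_const C
  have d3 := d2.congr_of_eventuallyEq
    (f₁ := a) (by filter_upwards [lt_mem_nhds ht] with x hx using key x hx.le)
  refine d3.congr_deriv ?_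
  rw [hmul t 1 ht.le zero_le_one]
  ring

/-! ### Termwise differentiation of series of monotone functions. -/

section TermwiseDerivative

variable {ι : Type*} {ν : ι → ℝ} {H : ℝ → ℝ} {g : ι → ℝ → ℝ}

theorem monotoneOn_deriv_nonneg {f : ℝ → ℝ} {f' t : ℝ} (hf : MonotoneOn f (Ioi 0)) (ht : 0 < t)
    (hd : HasDerivAt f f' t) : 0 ≤ f' := by
  rw [← hd.hasDerivWithinAt.derivWithin (isOpen_Ioi.uniqueDiffWithinAt (mem_Ioi.2 ht))]
  exact hf.derivWithin_nonneg

/-- Removing finitely many terms from a series of nondecreasing functions leaves a nondecreasing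
function. The weights are later both `μ` and the rows of `K`. -/
theorem sum_deriv_le_deriv (hν : ∀ i, 0 ≤ ν i) (hmono : ∀ i, MonotoneOn (g i) (Ioi 0))
    (hH : ∀ s, 0 < s → HasSum (fun i => ν i * g i s) (H s)) {t : ℝ} (ht : 0 < t) {g' : ι → ℝ}
    {H' : ℝ} (hg : ∀ i, HasDerivAt (g i) (g' i) t) (hd : HasDerivAt H H' t) (F : Finset ι) :
    ∑ i ∈ F, ν i * g' i ≤ H' := by
  have h1 : MonotoneOn (fun s => H s - ∑ i ∈ F, ν i * g i s) (Ioi 0) := by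
    intro x hx y hy hxy
    have h2 := sum_le_hasSum F (fun i _ => sub_nonneg.2
      (mul_le_mul_of_nonneg_left (hmono i hx hy hxy) (hν i))) ((hH y hy).sub (hH x hx))
    rw [Finset.sum_sub_distrib] at h2
    simp only
    linarith
  have h3 := monotoneOn_deriv_nonneg h1 ht
    (hd.sub (HasDerivAt.fun_sum fun i _ => (hg i).const_mul (ν i)))
  linarith

/-- A form of Fubini's theorem on the termwise differentiation of series of monotone functions. -/
theorem exists_hasSum_deriv [Countable ι] (hν : ∀ i, 0 ≤ ν i)
    (hmono : ∀ i, MonotoneOn (g i) (Ioi 0))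
    (hH : ∀ s, 0 < s → HasSum (fun i => ν i * g i s) (H s)) {g' : ι → ℝ → ℝ} {H' : ℝ → ℝ}
    (hg : ∀ i s, 0 < s → HasDerivAt (g i) (g' i s) s) (hd : ∀ s, 0 < s → HasDerivAt H (H' s) s)
    {t : ℝ} (ht : 0 < t) : ∃ s, 0 < s ∧ s < t ∧ HasSum (fun i => ν i * g' i s) (H' s) := by
  have hg0 : ∀ i s, 0 < s → 0 ≤ ν i * g' i s := fun i s hs =>
    mul_nonneg (hν i) (monotoneOn_deriv_nonneg (hmono i) hs (hg i s hs))
  have hle : ∀ s, 0 < s → ∀ F : Finset ι, ∑ i ∈ F, ν i * g' i s ≤ H' s := fun s hs =>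
    sum_deriv_le_deriv hν hmono hH hs (fun i => hg i s hs) (hd s hs)
  have hsm : ∀ s, 0 < s → Summable fun i => ν i * g' i s := fun s hs =>
    summable_of_sum_le (fun i => hg0 i s hs) (hle s hs)
  have hH0 : ∀ s, 0 < s → 0 ≤ H' s := fun s hs => by simpa using hle s hs ∅
  -- Any nondegenerate compact interval inside `(0, t)` would serve.
  have hx : 0 < t / 3 := by positivity
  have hxy : t / 3 ≤ t / 2 := by linarith
  -- A nonnegative derivative is automatically integrable, so the fundamental theorem of calculus
  -- needs no continuity of `G'`.
  have hint : ∀ {G G' : ℝ → ℝ}, (∀ s, 0 < s → HasDerivAt G (G' s) s) → (∀ s, 0 < s → 0 ≤ G' s) →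
      AEMeasurable (fun s => ENNReal.ofReal (G' s)) (volume.restrict (Ioc (t / 3) (t / 2))) ∧
      ∫⁻ s in Ioc (t / 3) (t / 2), ENNReal.ofReal (G' s) =
        ENNReal.ofReal (G (t / 2) - G (t / 3)) := by
    intro G G' h1 h2
    have h3 : ContinuousOn G (Icc (t / 3) (t / 2)) := fun s hs =>
      (h1 s (hx.trans_le hs.1)).continuousAt.continuousWithinAt
    have h4 : IntegrableOn G' (Ioc (t / 3) (t / 2)) :=
      intervalIntegral.integrableOn_deriv_of_nonneg h3 (fun s hs => h1 s (hx.trans hs.1))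
        fun s hs => h2 s (hx.trans hs.1)
    have h5 := intervalIntegral.integral_eq_sub_of_hasDerivAt_of_le hxy h3
      (fun s hs => h1 s (hx.trans hs.1)) ((intervalIntegrable_iff_integrableOn_Ioc_of_le hxy).2 h4)
    refine ⟨h4.aemeasurable.ennreal_ofReal, ?_⟩
    rw [← h5, intervalIntegral.integral_of_le hxy, ofReal_integral_eq_lintegral_ofReal h4]
    exact (ae_restrict_mem measurableSet_Ioc).mono fun s hs => h2 s (hx.trans hs.1)
  have hi := fun i => hint (G := fun s => ν i * g i s) (G' := fun s => ν i * g' i s)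
    (fun s hs => (hg i s hs).const_mul (ν i)) (hg0 i)
  have hI := hint hd hH0
  have hS : ∫⁻ s in Ioc (t / 3) (t / 2), ∑' i, ENNReal.ofReal (ν i * g' i s) =
      ENNReal.ofReal (H (t / 2) - H (t / 3)) := by
    rw [lintegral_tsum fun i => (hi i).1, tsum_congr fun i => (hi i).2,
      ← ((hH _ (by positivity)).sub (hH _ hx)).tsum_eq, ENNReal.ofReal_tsum_of_nonneg]
    · intro i
      rw [← mul_sub]
      exact mul_nonneg (hν i) (sub_nonneg.2 (hmono i hx (hx.trans_le hxy) hxy))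
    · exact ((hH _ (by positivity)).sub (hH _ hx)).summable
  -- The series of derivatives is at most `H'` and has the same finite integral, so the two agree
  -- almost everywhere.
  have hae := ae_eq_of_ae_le_of_lintegral_le (μ := volume.restrict (Ioc (t / 3) (t / 2)))
    (f := fun s => ∑' i, ENNReal.ofReal (ν i * g' i s)) (g := fun s => ENNReal.ofReal (H' s))
    ((ae_restrict_mem measurableSet_Ioc).mono fun s hs => by
      have hs0 : 0 < s := hx.trans hs.1
      simp only
      rw [← ENNReal.ofReal_tsum_of_nonneg (fun i => hg0 i s hs0) (hsm s hs0)]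
      exact ENNReal.ofReal_le_ofReal ((hsm s hs0).tsum_le_of_sum_le (hle s hs0)))
    (by rw [hS]; exact ENNReal.ofReal_ne_top) hI.1 (by rw [hI.2, hS])
  have : (volume.restrict (Ioc (t / 3) (t / 2))) ≠ 0 := by
    rw [Ne, Measure.restrict_eq_zero, Real.volume_Ioc, ENNReal.ofReal_eq_zero]
    linarith
  have : (ae (volume.restrict (Ioc (t / 3) (t / 2)))).NeBot := ae_neBot.2 this
  obtain ⟨s, hs, hsI⟩ := (hae.and (ae_restrict_mem measurableSet_Ioc)).exists
  have hs0 : 0 < s := hx.trans hsI.1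
  refine ⟨s, hs0, by linarith [hsI.2], ?_⟩
  have e := (hsm s hs0).hasSum
  simp only at hs
  rw [← ENNReal.ofReal_tsum_of_nonneg (fun i => hg0 i s hs0) (hsm s hs0),
    ENNReal.ofReal_eq_ofReal_iff (tsum_nonneg fun i => hg0 i s hs0) (hH0 s hs0)] at hs
  rwa [hs] at e

end TermwiseDerivative

/-- Let `f_i` solve `f_i (t + s) = ∑ k, K t i k * f_k s`, and let `m = ∑ i, μ i * f_i` where `μ` is
subinvariant for `K` up to the factor `a`. If `exp (c t) * f_i t` is nondecreasing for all `i` and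
`m' + c * m` is invariant up to `a`, then `m` can be differentiated term by term. -/
theorem hasSum_deriv_of_subinvariant {ι : Type*} [Countable ι] {μ : ι → ℝ} {K : ℝ → ι → ι → ℝ}
    {f f' : ι → ℝ → ℝ} {m m' a : ℝ → ℝ} {c : ℝ} (hμ : ∀ i, 0 ≤ μ i) (hK : ∀ t i k, 0 ≤ K t i k)
    (hf : ∀ i t, 0 < t → HasDerivAt (f i) (f' i t) t)
    (hmono : ∀ i, MonotoneOn (fun t => Real.exp (c * t) * f i t) (Ioi 0))
    (hm : ∀ t, 0 < t → HasSum (fun i => μ i * f i t) (m t))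
    (hm' : ∀ t, 0 < t → HasDerivAt m (m' t) t)
    (hCK : ∀ t s, 0 < t → 0 < s → ∀ i, HasSum (fun k => K t i k * f k s) (f i (t + s)))
    (hμK : ∀ t, 0 < t → ∀ k, Summable (fun i => μ i * K t i k) ∧
      a t * μ k ≤ ∑' i, μ i * K t i k)
    (hma : ∀ t s, 0 < t → 0 < s → m' (t + s) + c * m (t + s) = a t * (m' s + c * m s))
    {t : ℝ} (ht : 0 < t) : HasSum (fun i => μ i * f' i t) (m' t) := by
  have hexp : ∀ {φ : ℝ → ℝ} {φ' s : ℝ}, HasDerivAt φ φ' s →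
      HasDerivAt (fun t => Real.exp (c * t) * φ t) (Real.exp (c * s) * (φ' + c * φ s)) s := by
    intro φ φ' s h
    refine ((((hasDerivAt_id s).const_mul c).exp).mul h).congr_deriv ?_
    simp only [id]
    ring
  -- Up to a positive exponential, `f' + c * f` is the derivative of the monotone function; the
  -- argument runs on these nonnegative quantities.
  have hv : ∀ i s, 0 < s → 0 ≤ f' i s + c * f i s := fun i s hs =>
    nonneg_of_mul_nonneg_right (monotoneOn_deriv_nonneg (hmono i) hs (hexp (hf i s hs)))
      (Real.exp_pos _)
  have hG : ∀ s, 0 < s → HasSum (fun i => μ i * (Real.exp (c * s) * f i s))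
      (Real.exp (c * s) * m s) := by
    intro s hs
    exact ((hm s hs).mul_left (Real.exp (c * s))).of_forall_eq fun i => by ring
  have hup : ∀ s, 0 < s → ∀ F : Finset ι, ∑ i ∈ F, μ i * (f' i s + c * f i s) ≤
      m' s + c * m s := by
    intro s hs F
    have := sum_deriv_le_deriv hμ hmono hG hs (fun i => hexp (hf i s hs)) (hexp (hm' s hs)) F
    refine le_of_mul_le_mul_left ?_ (Real.exp_pos (c * s))
    rw [Finset.mul_sum]
    exact (Finset.sum_congr rfl fun i _ => by ring).trans_le this
  obtain ⟨s, hs, hst, hsum⟩ := exists_hasSum_deriv hμ hmono hG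
    (fun i s hs => hexp (hf i s hs)) (fun s hs => hexp (hm' s hs)) ht
  have hsum' : HasSum (fun i => μ i * (f' i s + c * f i s)) (m' s + c * m s) := by
    have := hsum.mul_left (Real.exp (c * s))⁻¹
    rw [inv_mul_cancel_left₀ (Real.exp_ne_zero _)] at this
    exact this.of_forall_eq fun i => by field_simp
  set r := t - s with hr
  have hr0 : 0 < r := by linarith
  have htr : t = r + s := by ring
  -- Here the series is Chapman–Kolmogorov over the fixed time `r`, differentiated at `s`.
  have hlow : ∀ i, ∀ F : Finset ι, ∑ k ∈ F, K r i k * (f' k s + c * f k s) ≤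
      f' i t + c * f i t := by
    intro i F
    have h1 : HasDerivAt (fun x => Real.exp (c * x) * f i (r + x))
        (Real.exp (c * s) * (f' i t + c * f i t)) s := by
      have h2 : HasDerivAt (fun x => f i (r + x)) (f' i t) s :=
        HasDerivAt.comp_const_add r s (by rw [← htr]; exact hf i t ht)
      have := hexp h2
      rwa [← htr] at this
    have := sum_deriv_le_deriv (hK r i) hmono (H := fun x => Real.exp (c * x) * f i (r + x))
      (fun x hx => by
        exact ((hCK r x hr0 hx i).mul_left (Real.exp (c * x))).of_forall_eq fun k => by ring) hs (fun k => hexp (hf k s hs)) h1 F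
    refine le_of_mul_le_mul_left ?_ (Real.exp_pos (c * s))
    rw [Finset.mul_sum]
    exact (Finset.sum_congr rfl fun i _ => by ring).trans_le this
  have hsm : Summable fun i => μ i * (f' i t + c * f i t) :=
    summable_of_sum_le (fun i => mul_nonneg (hμ i) (hv i t ht)) (hup t ht)
  -- The exact identity at `s` is multiplied by `a r`, then `a r * μ k` is replaced by `(μ K) k`,
  -- the sums are exchanged, and `hlow` applies row by row.
  have hge : m' t + c * m t ≤ ∑' i, μ i * (f' i t + c * f i t) := by
    rw [htr, hma r s hr0 hs, ← htr, ← (hsum'.mul_left (a r)).tsum_eq]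
    refine (hsum'.mul_left (a r)).summable.tsum_le_of_sum_le fun F => ?_
    have h3 : ∀ k ∈ F, Summable fun i => μ i * (K r i k * (f' k s + c * f k s)) := fun k _ => by
      exact (summable_congr fun i => by ring).1
        ((hμK r hr0 k).1.mul_right (f' k s + c * f k s))
    calc ∑ k ∈ F, a r * (μ k * (f' k s + c * f k s))
        ≤ ∑ k ∈ F, ∑' i, μ i * (K r i k * (f' k s + c * f k s)) := by
          refine Finset.sum_le_sum fun k _ => ?_
          rw [← mul_assoc]
          simp_rw [← mul_assoc (μ _)]
          rw [tsum_mul_right]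
          exact mul_le_mul_of_nonneg_right (hμK r hr0 k).2 (hv k s hs)
      _ = ∑' i, ∑ k ∈ F, μ i * (K r i k * (f' k s + c * f k s)) :=
          (Summable.tsum_finsetSum h3).symm
      _ ≤ _ := by
          refine (summable_sum h3).tsum_le_tsum (fun i => ?_) hsm
          rw [← Finset.mul_sum]
          exact mul_le_mul_of_nonneg_left (hlow i F) (hμ i)
  have heq : ∑' i, μ i * (f' i t + c * f i t) = m' t + c * m t :=
    le_antisymm (hsm.tsum_le_of_sum_le (hup t ht)) hge
  have h5 := (heq ▸ hsm.hasSum).sub ((hm t ht).mul_left c)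
  rw [add_sub_cancel_right] at h5
  exact h5.of_forall_eq fun i => by ring

/-! ### The Markov property with respect to the past. -/

namespace CTMarkovChain

variable {S Ω : Type*} [MeasurableSpace Ω] (M : CTMarkovChain S Ω)

instance (i : S) : IsProbabilityMeasure (M.P i) := M.isProbabilityMeasure i

/-- The σ-algebra generated by `X_s`, `s ≤ t`. -/
@[reducible]
def past (t : ℝ≥0) : MeasurableSpace Ω :=
  MeasurableSpace.generateFrom {A | ∃ (F : Finset ℝ≥0) (x : ℝ≥0 → S),
    (∀ s ∈ F, s ≤ t) ∧ A = {ω | ∀ s ∈ F, M.X s ω = x s}}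

theorem past_le (t : ℝ≥0) : M.past t ≤ ‹MeasurableSpace Ω› := by
  refine MeasurableSpace.generateFrom_le ?_
  rintro _ ⟨F, x, -, rfl⟩
  simp only [ofPred_forall]
  exact F.measurableSet_biInter fun s _ => M.measurableSet_eq s (x s)

theorem past_mono {s t : ℝ≥0} (h : s ≤ t) : M.past s ≤ M.past t := by
  refine MeasurableSpace.generateFrom_mono ?_
  rintro _ ⟨F, x, hF, rfl⟩
  exact ⟨F, x, fun r hr => (hF r hr).trans h, rfl⟩

theorem measurableSet_past_eq {s t : ℝ≥0} (h : s ≤ t) (j : S) :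
    MeasurableSet[M.past t] {ω | M.X s ω = j} :=
  MeasurableSpace.measurableSet_generateFrom ⟨{s}, fun _ => j, by simpa using h, by simp⟩

theorem measurableSet_past_mem [Countable S] {s t : ℝ≥0} (h : s ≤ t) (C : Set S) :
    MeasurableSet[M.past t] {ω | M.X s ω ∈ C} := by
  have : {ω | M.X s ω ∈ C} = ⋃ j ∈ C, {ω | M.X s ω = j} := by ext; simp
  rw [this]
  exact MeasurableSet.biUnion C.to_countable fun j _ => M.measurableSet_past_eq h j

theorem isPiSystem_past (t : ℝ≥0) : IsPiSystem {A | ∃ (F : Finset ℝ≥0) (x : ℝ≥0 → S),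
    (∀ s ∈ F, s ≤ t) ∧ A = {ω | ∀ s ∈ F, M.X s ω = x s}} := by
  classical
  rintro _ ⟨F, x, hF, rfl⟩ _ ⟨G, y, hG, rfl⟩ ⟨ω₀, h1, h2⟩
  -- A point of the intersection provides prescribed values compatible with both `x` and `y`.
  refine ⟨F ∪ G, fun s => M.X s ω₀, fun s hs => ?_, ?_⟩
  · rcases Finset.mem_union.1 hs with h | h
    exacts [hF s h, hG s h]
  · ext ω
    simp only [mem_inter_iff, mem_ofPred_eq, Finset.mem_union] at h1 h2 ⊢
    constructor
    · rintro ⟨h3, h4⟩ s (hs | hs)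
      exacts [(h3 s hs).trans (h1 s hs).symm, (h4 s hs).trans (h2 s hs).symm]
    · exact fun h => ⟨fun s hs => (h s (Or.inl hs)).trans (h1 s hs),
        fun s hs => (h s (Or.inr hs)).trans (h2 s hs)⟩

/-- Dynkin's π-λ argument, starting from the finite cylinders of `markov`; complements use the case
of no past times. -/
theorem markov_past (i : S) {t : ℝ≥0} (h : ℝ≥0) (j k : S) {A : Set Ω}
    (hA : MeasurableSet[M.past t] A) :
    M.P i (A ∩ ({ω | M.X t ω = j} ∩ {ω | M.X (t + h) ω = k})) =
      M.P i (A ∩ {ω | M.X t ω = j}) * M.P j {ω | M.X h ω = k} := by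
  have hB := M.measurableSet_eq t j
  have hC := hB.inter (M.measurableSet_eq (t + h) k)
  induction A, hA using MeasurableSpace.induction_on_inter (m := M.past t) rfl
    (M.isPiSystem_past t) with
  | empty => simp
  | basic A hA =>
    obtain ⟨F, x, hF, rfl⟩ := hA
    exact M.markov i F x t h j k hF
  | compl A hA ih =>
    have hA' := M.past_le t _ hA
    have h0 := M.markov i ∅ (fun _ => j) t h j k (by simp)
    simp only [Finset.notMem_empty, false_implies, implies_true, true_and] at h0
    have e : ∀ B, M.P i (A ∩ B) + M.P i (Aᶜ ∩ B) = M.P i B := fun B => by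
      rw [inter_comm A, inter_comm Aᶜ, ← sdiff_eq, measure_inter_add_sdiff B hA']
    refine (ENNReal.add_right_inj (measure_ne_top (M.P i)
      (A ∩ ({ω | M.X t ω = j} ∩ {ω | M.X (t + h) ω = k})))).1 ?_
    rw [e, ih, ← add_mul, e]
    exact h0
  | iUnion f hd hf ih =>
    simp only [iUnion_inter]
    rw [measure_iUnion (fun a b hab => ((hd hab).mono inter_subset_left inter_subset_left))
      (fun n => (M.past_le t _ (hf n)).inter hC),
      measure_iUnion (fun a b hab => ((hd hab).mono inter_subset_left inter_subset_left))
      (fun n => (M.past_le t _ (hf n)).inter hB), ← ENNReal.tsum_mul_right]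
    exact tsum_congr ih

/-! ### Dyadic skeletons of the killed chain. -/

/-- The event that `X` avoids `D` at the times `t, t + δ, …, t + n δ` and is in `j` at the last
one of these. -/
def gridEvent (D : Set S) (t δ : ℝ≥0) (n : ℕ) (j : S) : Set Ω :=
  {ω | (∀ k : ℕ, k ≤ n → M.X (t + k * δ) ω ∉ D) ∧ M.X (t + n * δ) ω = j}

/-- The event that `X` avoids `D` on `[t, t + s]` and is in `j` at time `t + s`. -/
def survEvent (D : Set S) (t s : ℝ≥0) (j : S) : Set Ω :=
  {ω | (∀ r, t ≤ r → r ≤ t + s → M.X r ω ∉ D) ∧ M.X (t + s) ω = j}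

variable (D : Set S)

theorem measurableSet_gridEvent [Countable S] (t δ : ℝ≥0) (n : ℕ) (j : S) :
    MeasurableSet[M.past (t + n * δ)] (M.gridEvent D t δ n j) := by
  have : M.gridEvent D t δ n j = (⋂ k : ℕ, ⋂ _ : k ≤ n, {ω | M.X (t + k * δ) ω ∈ Dᶜ}) ∩
      {ω | M.X (t + n * δ) ω = j} := by
    ext; simp [gridEvent]
  rw [this]
  refine MeasurableSet.inter (MeasurableSet.iInter fun k => MeasurableSet.iInter fun hk => ?_)
    (M.measurableSet_past_eq le_rfl j)
  exact M.measurableSet_past_mem (by gcongr) _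

theorem gridEvent_of_mem {D : Set S} {j : S} (hj : j ∈ D) (t δ : ℝ≥0) (n : ℕ) :
    M.gridEvent D t δ n j = ∅ := by
  refine eq_empty_of_forall_notMem fun ω hω => hω.1 n le_rfl ?_
  rwa [hω.2]

theorem survEvent_of_mem {D : Set S} {j : S} (hj : j ∈ D) (t s : ℝ≥0) :
    M.survEvent D t s j = ∅ := by
  refine eq_empty_of_forall_notMem fun ω hω => hω.1 (t + s) le_self_add le_rfl ?_
  rwa [hω.2]

/-- Split according to the state `l` at the `n`-th grid time and apply the Markov property there. -/
theorem measure_inter_gridEvent_succ [Countable S] (i : S) {t : ℝ≥0} (δ : ℝ≥0) (n : ℕ) {j : S}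
    (hj : j ∉ D) {A : Set Ω} (hA : MeasurableSet[M.past t] A) :
    M.P i (A ∩ M.gridEvent D t δ (n + 1) j) =
      ∑' l, M.P i (A ∩ M.gridEvent D t δ n l) * M.P l {ω | M.X δ ω = j} := by
  have hA' : ∀ l, MeasurableSet[M.past (t + n * δ)] (A ∩ M.gridEvent D t δ n l) := fun l =>
    (M.past_mono le_self_add _ hA).inter (M.measurableSet_gridEvent D t δ n l)
  have h1 : A ∩ M.gridEvent D t δ (n + 1) j = ⋃ l, (A ∩ M.gridEvent D t δ n l) ∩
      ({ω | M.X (t + n * δ) ω = l} ∩ {ω | M.X (t + n * δ + δ) ω = j}) := by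
    have e : t + ((n + 1 : ℕ) : ℝ≥0) * δ = t + n * δ + δ := by push_cast; ring
    ext ω
    simp only [gridEvent, mem_inter_iff, mem_ofPred_eq, mem_iUnion]
    constructor
    · rintro ⟨h1, h2, h3⟩
      exact ⟨_, ⟨h1, fun k hk => h2 k (hk.trans n.le_succ), rfl⟩, rfl, e ▸ h3⟩
    · rintro ⟨l, ⟨h1, h2, -⟩, -, h3⟩
      refine ⟨h1, fun k hk => ?_, by rw [e]; exact h3⟩
      rcases Nat.le_succ_iff.1 hk with h | rfl
      · exact h2 k h
      · rwa [Nat.succ_eq_add_one, e, h3]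
  rw [h1, measure_iUnion]
  · refine tsum_congr fun l => ?_
    rw [M.markov_past i δ l j (hA' l)]
    congr 2
    ext ω
    simp only [gridEvent, mem_inter_iff, mem_ofPred_eq]
    tauto
  · intro l l' hl
    refine disjoint_left.2 fun ω h h' => hl (h.2.1.symm.trans h'.2.1)
  · exact fun l => (M.past_le _ _ (hA' l)).inter
      ((M.measurableSet_eq _ _).inter (M.measurableSet_eq _ _))

theorem measure_start (i : S) : M.P i {ω | M.X 0 ω = i}ᶜ = 0 :=
  (prob_compl_eq_zero_iff (M.measurableSet_eq 0 i)).2 (M.start i)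

theorem measure_gridEvent_succ [Countable S] (i : S) (δ : ℝ≥0) (n : ℕ) {j : S} (hj : j ∉ D) :
    M.P i (M.gridEvent D 0 δ (n + 1) j) =
      ∑' l, M.P i (M.gridEvent D 0 δ n l) * M.P l {ω | M.X δ ω = j} := by
  simpa using M.measure_inter_gridEvent_succ D i δ n hj (t := 0) (A := univ) MeasurableSet.univ

theorem measure_gridEvent_zero_self {i : S} (hi : i ∉ D) (δ : ℝ≥0) :
    M.P i (M.gridEvent D 0 δ 0 i) = 1 := by
  rw [← M.start i]
  congr 1
  ext ω
  simp only [gridEvent, mem_ofPred_eq, Nat.le_zero, forall_eq, Nat.cast_zero, zero_mul, add_zero]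
  exact ⟨fun h => h.2, fun h => ⟨by rwa [h], h⟩⟩

theorem measure_inter_gridEvent [Countable S] (i k : S) {t : ℝ≥0} (δ : ℝ≥0) (n : ℕ) (j : S)
    {A : Set Ω} (hA : MeasurableSet[M.past t] A) :
    M.P i (A ∩ {ω | M.X t ω = k} ∩ M.gridEvent D t δ n j) =
      M.P i (A ∩ {ω | M.X t ω = k}) * M.P k (M.gridEvent D 0 δ n j) := by
  by_cases hj : j ∈ D
  · simp [M.gridEvent_of_mem hj]
  have hA' : MeasurableSet[M.past t] (A ∩ {ω | M.X t ω = k}) :=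
    hA.inter (M.measurableSet_past_eq le_rfl k)
  induction n generalizing j with
  | zero =>
    by_cases hkj : k = j
    · subst hkj
      rw [M.measure_gridEvent_zero_self D hj, mul_one]
      congr 1
      ext ω
      simp only [gridEvent, mem_inter_iff, mem_ofPred_eq, Nat.le_zero, forall_eq, Nat.cast_zero,
        zero_mul, add_zero, and_iff_left_iff_imp, and_imp]
      exact fun _ h => ⟨by rwa [h], h⟩
    · have h1 : A ∩ {ω | M.X t ω = k} ∩ M.gridEvent D t δ 0 j = ∅ := by
        refine eq_empty_of_forall_notMem fun ω hω => hkj ?_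
        have := hω.2.2
        simp only [Nat.cast_zero, zero_mul, add_zero] at this
        exact hω.1.2.symm.trans this
      have h2 : M.P k (M.gridEvent D 0 δ 0 j) = 0 := by
        refine measure_mono_null (fun ω hω => ?_) (M.measure_start k)
        refine fun h => hkj ?_
        have := hω.2
        simp only [Nat.cast_zero, zero_mul, add_zero] at this
        exact h.symm.trans this
      rw [h1, h2, measure_empty, mul_zero]
  | succ n ih =>
    rw [M.measure_inter_gridEvent_succ D i δ n hj hA', M.measure_gridEvent_succ D k δ n hj,
      ← ENNReal.tsum_mul_left]
    refine tsum_congr fun l => ?_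
    by_cases hl : l ∈ D
    · simp [M.gridEvent_of_mem hl]
    · rw [ih l hl, mul_assoc]

theorem antitone_gridEvent (t s : ℝ≥0) (j : S) :
    Antitone fun m : ℕ => M.gridEvent D t (s / 2 ^ m) (2 ^ m) j := by
  refine antitone_nat_of_succ_le fun m ω hω => ⟨fun k hk => ?_, ?_⟩
  -- The `k`-th point of a dyadic grid is the `2k`-th point of the next one.
  · have := hω.1 (2 * k) (by rw [pow_succ]; omega)
    convert this using 3
    push_cast
    rw [pow_succ]
    field_simp
  · rw [← hω.2]
    congr 2
    push_cast
    field_simp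

/-- A visit to `D` at time `r` lasts for a while to the right of `r`, so a fine enough grid detects
it. -/
theorem iInter_gridEvent (t s : ℝ≥0) (j : S) :
    ⋂ m : ℕ, M.gridEvent D t (s / 2 ^ m) (2 ^ m) j = M.survEvent D t s j := by
  have e : ∀ m : ℕ, (2 : ℝ≥0) ^ m * (s / 2 ^ m) = s := fun m => by field_simp
  ext ω
  simp only [mem_iInter, gridEvent, survEvent, mem_ofPred_eq, Nat.cast_pow, Nat.cast_ofNat, e]
  constructor
  · intro h
    refine ⟨fun r htr hrs hD => ?_, (h 0).2⟩
    -- The right endpoint has no room to its right, but it belongs to every grid.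
    rcases hrs.eq_or_lt with rfl | hrs
    · have := (h 0).1 1 le_rfl
      simp only [Nat.cast_one, pow_zero, div_one, one_mul] at this
      exact this hD
    obtain ⟨u, hu, hur⟩ := (mem_nhdsGT_iff_exists_Ioo_subset' hrs).1 (M.rightCont ω r)
    obtain ⟨m, hm⟩ : ∃ m : ℕ, s / 2 ^ m < min u (t + s) - r := by
      have h0 : 0 < min u (t + s) - r := tsub_pos_of_lt (lt_min hu hrs)
      have : Tendsto (fun m : ℕ => s * (1 / 2) ^ m) atTop (𝓝 (s * 0)) :=
        (NNReal.tendsto_pow_atTop_nhds_zero_of_lt_one (by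
          rw [div_lt_one] <;> norm_num)).const_mul s
      rw [mul_zero] at this
      obtain ⟨m, hm⟩ := ((tendsto_order.1 this).2 _ h0).exists
      exact ⟨m, by simpa [div_eq_mul_inv] using hm⟩
    have hs : 0 < s := by
      by_contra h0
      simp only [not_lt, nonpos_iff_eq_zero] at h0
      rw [h0, add_zero] at hrs
      exact absurd hrs (not_lt.2 htr)
    have hδ : 0 < s / 2 ^ m := by positivity
    set δ := s / 2 ^ m with hδd
    -- The first grid point strictly after `r`, which lies within `δ` of `r`.
    set k := ⌊(r - t) / δ⌋₊ + 1 with hk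
    have h1 : (r - t) / δ < k := by rw [hk]; push_cast; exact Nat.lt_floor_add_one _
    have h2 : (k : ℝ≥0) ≤ (r - t) / δ + 1 := by
      rw [hk]; push_cast; gcongr; exact Nat.floor_le zero_le
    rw [div_lt_iff₀ hδ] at h1
    have h3 : (k : ℝ≥0) * δ ≤ (r - t) + δ := by
      calc (k : ℝ≥0) * δ ≤ ((r - t) / δ + 1) * δ := by gcongr
        _ = _ := by field_simp
    have h4 : r < t + k * δ := by
      rw [← tsub_lt_iff_left htr]; exact h1
    have h5 : t + k * δ < min u (t + s) := by
      calc t + k * δ ≤ t + (r - t + δ) := by gcongr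
        _ = r + δ := by rw [← add_assoc, add_tsub_cancel_of_le htr]
        _ < _ := by rw [add_comm]; exact lt_tsub_iff_right.1 hm
    have h6 : M.X (t + k * δ) ω = M.X r ω := hur ⟨h4, h5.trans_le (min_le_left _ _)⟩
    refine (h m).1 k ?_ (by rw [← hδd, h6]; exact hD)
    have h7 : (k : ℝ≥0) * δ < 2 ^ m * δ := by
      rw [e m]
      exact lt_of_add_lt_add_left (h5.trans_le (min_le_right _ _))
    have h8 := lt_of_mul_lt_mul_right h7 zero_le
    exact_mod_cast h8.le
  · rintro ⟨h1, h2⟩ m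
    refine ⟨fun k hk => h1 _ le_self_add ?_, h2⟩
    have : (k : ℝ≥0) ≤ 2 ^ m := by exact_mod_cast hk
    calc t + k * (s / 2 ^ m) ≤ t + 2 ^ m * (s / 2 ^ m) := by gcongr
      _ = t + s := by rw [e]

theorem measurableSet_survEvent [Countable S] (t s : ℝ≥0) (j : S) :
    MeasurableSet[M.past (t + s)] (M.survEvent D t s j) := by
  rw [← iInter_gridEvent]
  refine MeasurableSet.iInter fun m => ?_
  have := M.measurableSet_gridEvent D t (s / 2 ^ m) (2 ^ m) j
  have e : ((2 ^ m : ℕ) : ℝ≥0) * (s / 2 ^ m) = s := by push_cast; field_simp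
  rwa [e] at this

theorem tendsto_measure_inter_gridEvent [Countable S] (i : S) (t s : ℝ≥0) (j : S) {A : Set Ω}
    (hA : MeasurableSet A) :
    Tendsto (fun m : ℕ => M.P i (A ∩ M.gridEvent D t (s / 2 ^ m) (2 ^ m) j)) atTop
      (𝓝 (M.P i (A ∩ M.survEvent D t s j))) := by
  rw [← iInter_gridEvent, inter_iInter]
  exact tendsto_measure_iInter_atTop
    (fun m => (hA.inter (M.past_le _ _ (M.measurableSet_gridEvent D _ _ _ j))).nullMeasurableSet)
    (fun m n h => inter_subset_inter_right _ (M.antitone_gridEvent D t s j h))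
    ⟨0, measure_ne_top _ _⟩

theorem tendsto_measure_gridEvent [Countable S] (i : S) (s : ℝ≥0) (j : S) :
    Tendsto (fun m : ℕ => M.P i (M.gridEvent D 0 (s / 2 ^ m) (2 ^ m) j)) atTop
      (𝓝 (M.P i (M.survEvent D 0 s j))) := by
  simpa using M.tendsto_measure_inter_gridEvent D i 0 s j MeasurableSet.univ

/-- The grid identity passes to the decreasing limit on both sides. -/
theorem measure_inter_survEvent [Countable S] (i k : S) {t : ℝ≥0} (s : ℝ≥0) (j : S)
    {A : Set Ω} (hA : MeasurableSet[M.past t] A) :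
    M.P i (A ∩ {ω | M.X t ω = k} ∩ M.survEvent D t s j) =
      M.P i (A ∩ {ω | M.X t ω = k}) * M.P k (M.survEvent D 0 s j) := by
  refine tendsto_nhds_unique (M.tendsto_measure_inter_gridEvent D i t s j
    ((M.past_le _ _ hA).inter (M.measurableSet_eq t k))) ?_
  simp_rw [M.measure_inter_gridEvent D i k _ _ j hA]
  exact ENNReal.Tendsto.const_mul (M.tendsto_measure_gridEvent D k s j)
    (Or.inr (measure_ne_top _ _))

theorem measure_survEvent_add [Countable S] (i : S) (t s : ℝ≥0) (j : S) :
    M.P i (M.survEvent D 0 (t + s) j) =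
      ∑' k, M.P i (M.survEvent D 0 t k) * M.P k (M.survEvent D 0 s j) := by
  have hA : ∀ k, MeasurableSet[M.past t] (M.survEvent D 0 t k) := fun k => by
    have := M.measurableSet_survEvent D 0 t k
    rwa [zero_add] at this
  have h0 : ∀ k, M.survEvent D 0 t k ∩ {ω | M.X t ω = k} = M.survEvent D 0 t k := fun k =>
    inter_eq_left.2 fun ω hω => by simpa using hω.2
  have h1 : M.survEvent D 0 (t + s) j =
      ⋃ k, M.survEvent D 0 t k ∩ {ω | M.X t ω = k} ∩ M.survEvent D t s j := by
    ext ω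
    simp only [survEvent, mem_iUnion, mem_inter_iff, mem_ofPred_eq, zero_add]
    constructor
    · rintro ⟨h1, h2⟩
      exact ⟨_, ⟨⟨fun r _ hr => h1 r zero_le (hr.trans le_self_add), rfl⟩, rfl⟩,
        fun r _ hr => h1 r zero_le hr, h2⟩
    · rintro ⟨k, ⟨⟨h1, -⟩, -⟩, h2, h3⟩
      exact ⟨fun r _ hr => (le_total r t).elim (fun h => h1 r zero_le h)
        fun h => h2 r h hr, h3⟩
  rw [h1, measure_iUnion]
  · refine tsum_congr fun k => ?_
    rw [M.measure_inter_survEvent D i k s j (hA k), h0]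
  · exact fun k l hkl => disjoint_left.2 fun ω h h' => hkl (h.1.2.symm.trans h'.1.2)
  · exact fun k => ((M.past_le _ _ (hA k)).inter (M.measurableSet_eq t k)).inter
      (M.past_le _ _ (M.measurableSet_survEvent D t s j))

/-- Right-continuity makes the inequality strict: a path outside `D` at `t` stays there a little
longer. -/
theorem lt_T_iff (t : ℝ≥0) (ω : Ω) : (t : ℝ≥0∞) < M.T D ω ↔ ∀ r ≤ t, M.X r ω ∉ D := by
  constructor
  · intro h r hr
    exact M.mem_compl_of_lt_T D ((ENNReal.coe_le_coe.2 hr).trans_lt h)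
  · intro h
    obtain ⟨u, hu, hur⟩ := mem_nhdsGT_iff_exists_Ioo_subset.1 (M.rightCont ω t)
    refine (ENNReal.coe_lt_coe.2 hu).trans_le (le_sInf ?_)
    rintro _ ⟨r, hr, rfl⟩
    refine ENNReal.coe_le_coe.2 (not_lt.1 fun hru => ?_)
    rcases le_or_gt r t with h1 | h1
    · exact h r h1 hr
    · have h2 : M.X r ω = M.X t ω := hur ⟨h1, hru⟩
      exact h t le_rfl (h2 ▸ hr)

theorem survEvent_zero_eq (t : ℝ≥0) (j : S) :
    M.survEvent D 0 t j = {ω | (t : ℝ≥0∞) < M.T D ω ∧ M.X t ω = j} := by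
  ext ω
  simp [survEvent, lt_T_iff]

theorem pow_le_measure_gridEvent [Countable S] {i : S} (hi : i ∉ D) (δ : ℝ≥0) (n : ℕ) :
    M.P i {ω | M.X δ ω = i} ^ n ≤ M.P i (M.gridEvent D 0 δ n i) := by
  induction n with
  | zero => rw [M.measure_gridEvent_zero_self D hi, pow_zero]
  | succ n ih =>
    rw [M.measure_gridEvent_succ D i δ n hi, pow_succ]
    exact (mul_le_mul_left ih _).trans (ENNReal.le_tsum i)

/-- Count the skeleton paths that wait in `i`, step to `j` once, and wait in `j`. There are `n`
choices for the step, and each path has at least the probability of the step times both `n`-th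
powers. -/
theorem mul_pow_le_measure_gridEvent [Countable S] {i j : S} (hi : i ∉ D) (hj : j ∉ D)
    (hij : i ≠ j) (δ : ℝ≥0) (n : ℕ) :
    n * M.P i {ω | M.X δ ω = j} * (M.P i {ω | M.X δ ω = i} ^ n * M.P j {ω | M.X δ ω = j} ^ n) ≤
      M.P i (M.gridEvent D 0 δ n j) := by
  induction n with
  | zero => simp
  | succ n ih =>
    rw [M.measure_gridEvent_succ D i δ n hj]
    set a := M.P i {ω | M.X δ ω = j}
    set x := M.P i {ω | M.X δ ω = i}
    set y := M.P j {ω | M.X δ ω = j}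
    have hx : x ≤ 1 := prob_le_one
    have hy : y ≤ 1 := prob_le_one
    calc ((n + 1 : ℕ) : ℝ≥0∞) * a * (x ^ (n + 1) * y ^ (n + 1))
        = x ^ n * x * a * y ^ (n + 1) + n * a * (x ^ n * y ^ n) * y * x := by push_cast; ring
      _ ≤ x ^ n * 1 * a * 1 ^ (n + 1) + n * a * (x ^ n * y ^ n) * y * 1 := by gcongr
      _ ≤ M.P i (M.gridEvent D 0 δ n i) * a + M.P i (M.gridEvent D 0 δ n j) * y := by
        simp only [mul_one, one_pow]
        gcongr
        exact M.pow_le_measure_gridEvent D hi δ n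
      _ = ∑ l ∈ (Finset.cons i {j} (by simpa using hij)),
          M.P i (M.gridEvent D 0 δ n l) * M.P l {ω | M.X δ ω = j} := by
        rw [Finset.sum_cons, Finset.sum_singleton]
      _ ≤ _ := ENNReal.sum_le_tsum _

end CTMarkovChain

/-! ### Real transition probabilities of the killed chain and their rates at time zero. -/

namespace CTMarkovChain

variable {S Ω : Type*} [MeasurableSpace Ω] (M : CTMarkovChain S Ω) (D : Set S)

/-- The probability `ℙ_i(X_t = j, t < T)`. -/
noncomputable def kT (t : ℝ≥0) (i j : S) : ℝ :=
  (M.P i).real (M.survEvent D 0 t j)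

/-- The probability `ℙ_i(t < T)`. -/
noncomputable def sT (t : ℝ≥0) (i : S) : ℝ :=
  (M.P i).real {ω | (t : ℝ≥0∞) < M.T D ω}

variable {D}

theorem kT_nonneg (t : ℝ≥0) (i j : S) : 0 ≤ M.kT D t i j := measureReal_nonneg

theorem sT_nonneg (t : ℝ≥0) (i : S) : 0 ≤ M.sT D t i := measureReal_nonneg

theorem sT_le_one (t : ℝ≥0) (i : S) : M.sT D t i ≤ 1 := measureReal_le_one

theorem kT_le_one (t : ℝ≥0) (i j : S) : M.kT D t i j ≤ 1 := measureReal_le_one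

theorem kT_le_p (t : ℝ≥0) (i j : S) : M.kT D t i j ≤ M.p t i j :=
  measureReal_mono fun ω hω => by simpa using hω.2

theorem kT_of_mem {j : S} (hj : j ∈ D) (t : ℝ≥0) (i : S) : M.kT D t i j = 0 := by
  simp [kT, M.survEvent_of_mem hj]

theorem p_zero_self (i : S) : M.p 0 i i = 1 := by
  simp [p, measureReal_def, M.start i]

theorem p_zero_of_ne {i j : S} (h : i ≠ j) : M.p 0 i j = 0 := by
  rw [p, measureReal_def, measure_mono_null _ (M.measure_start i), ENNReal.toReal_zero]
  intro ω hω h'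
  exact h (h'.symm.trans hω)

theorem measurableSet_survEvent_zero [Countable S] (t : ℝ≥0) (j : S) :
    MeasurableSet (M.survEvent D 0 t j) :=
  M.past_le _ _ (M.measurableSet_survEvent D 0 t j)

theorem lt_T_eq_iUnion (t : ℝ≥0) :
    {ω | (t : ℝ≥0∞) < M.T D ω} = ⋃ j, M.survEvent D 0 t j := by
  ext ω
  simp [survEvent_zero_eq]

theorem measurableSet_lt_T [Countable S] (t : ℝ≥0) :
    MeasurableSet {ω | (t : ℝ≥0∞) < M.T D ω} := by
  rw [lt_T_eq_iUnion]
  exact MeasurableSet.iUnion fun j => M.measurableSet_survEvent_zero t j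

theorem measure_lt_T [Countable S] (i : S) (t : ℝ≥0) :
    M.P i {ω | (t : ℝ≥0∞) < M.T D ω} = ∑' j, M.P i (M.survEvent D 0 t j) := by
  rw [lt_T_eq_iUnion, measure_iUnion _ fun j => M.measurableSet_survEvent_zero t j]
  exact fun k l hkl => disjoint_left.2 fun ω h h' => hkl (h.2.symm.trans h'.2)

theorem hasSum_toReal_of_tsum_eq {f : S → ℝ≥0∞} {x : ℝ≥0∞} (h : x = ∑' k, f k) (hx : x ≠ ∞) :
    HasSum (fun k => (f k).toReal) x.toReal := by
  subst h
  rw [ENNReal.tsum_toReal_eq fun k => ENNReal.ne_top_of_tsum_ne_top hx k]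
  exact ENNReal.hasSum_toReal hx

theorem hasSum_kT [Countable S] (t : ℝ≥0) (i : S) :
    HasSum (fun k => M.kT D t i k) (M.sT D t i) :=
  hasSum_toReal_of_tsum_eq (M.measure_lt_T i t) (measure_ne_top _ _)

theorem hasSum_p [Countable S] (t : ℝ≥0) (i : S) : HasSum (fun k => M.p t i k) 1 := by
  have h : M.P i univ = ∑' j, M.P i {ω | M.X t ω = j} := by
    rw [← measure_iUnion _ fun j => M.measurableSet_eq t j]
    · congr 1
      ext
      simp
    · exact fun k l hkl => disjoint_left.2 fun ω h h' => hkl (h.symm.trans h')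
  have := hasSum_toReal_of_tsum_eq h (measure_ne_top _ _)
  rwa [measure_univ, ENNReal.toReal_one] at this

theorem hasSum_kT_add [Countable S] (t s : ℝ≥0) (i j : S) :
    HasSum (fun k => M.kT D t i k * M.kT D s k j) (M.kT D (t + s) i j) :=
  (hasSum_toReal_of_tsum_eq (M.measure_survEvent_add D i t s j)
    (measure_ne_top _ _)).of_forall_eq fun k => by rw [ENNReal.toReal_mul]; rfl

theorem hasSum_sT_add [Countable S] (t s : ℝ≥0) (i : S) :
    HasSum (fun k => M.kT D t i k * M.sT D s k) (M.sT D (t + s) i) := by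
  have h : M.P i {ω | ((t + s : ℝ≥0) : ℝ≥0∞) < M.T D ω} =
      ∑' k, M.P i (M.survEvent D 0 t k) * M.P k {ω | (s : ℝ≥0∞) < M.T D ω} := by
    simp_rw [measure_lt_T, measure_survEvent_add, ← ENNReal.tsum_mul_left]
    exact ENNReal.tsum_comm
  exact (hasSum_toReal_of_tsum_eq h (measure_ne_top _ _)).of_forall_eq fun k => by
    rw [ENNReal.toReal_mul]; rfl

theorem hasDerivWithinAt_p (hM : M.HasQMatrix) (i j : S) :
    HasDerivWithinAt (fun t : ℝ => M.p t.toNNReal i j) (M.q i j) (Ici 0) 0 :=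
  (hM i j).hasDerivWithinAt

theorem tendsto_p_sub_div (hM : M.HasQMatrix) (i j : S) :
    Tendsto (fun h : ℝ => (M.p h.toNNReal i j - M.p 0 i j) / h) (𝓝[>] 0) (𝓝 (M.q i j)) := by
  have := (hasDerivWithinAt_iff_tendsto_slope' (by simp)).1
    ((M.hasDerivWithinAt_p hM i j).mono Ioi_subset_Ici_self)
  refine this.congr fun h => ?_
  simp [slope_def_field]

theorem tendsto_p_div (hM : M.HasQMatrix) {i j : S} (hij : i ≠ j) :
    Tendsto (fun h : ℝ => M.p h.toNNReal i j / h) (𝓝[>] 0) (𝓝 (M.q i j)) := by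
  simpa [M.p_zero_of_ne hij] using M.tendsto_p_sub_div hM i j

theorem tendsto_p_self_div (hM : M.HasQMatrix) (i : S) :
    Tendsto (fun h : ℝ => (M.p h.toNNReal i i - 1) / h) (𝓝[>] 0) (𝓝 (M.q i i)) := by
  simpa [M.p_zero_self] using M.tendsto_p_sub_div hM i i

theorem tendsto_p_pow (hM : M.HasQMatrix) (i : S) {h : ℝ≥0} (hh : 0 < h) :
    Tendsto (fun m : ℕ => M.p (h / 2 ^ m) i i ^ (2 ^ m)) atTop
      (𝓝 (Real.exp (M.q i i * h))) := by
  have := tendsto_pow_two_pow_exp (M.hasDerivWithinAt_p hM i i) (by simp [M.p_zero_self])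
    (NNReal.coe_pos.2 hh)
  refine this.congr fun m => ?_
  congr 2
  rw [← NNReal.coe_ofNat, ← NNReal.coe_pow, ← NNReal.coe_div, Real.toNNReal_coe]

/-- Waiting in `i` at all grid points is one way to survive and end in `i`; refine the grid. -/
theorem exp_le_kT_self [Countable S] (hM : M.HasQMatrix) {i : S} (hi : i ∉ D) (h : ℝ≥0) :
    Real.exp (M.q i i * h) ≤ M.kT D h i i := by
  rcases eq_or_ne h 0 with rfl | hh
  · have : M.P i (M.survEvent D 0 0 i) = 1 := by
      rw [← M.measure_gridEvent_zero_self D hi 0]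
      congr 1
      ext ω
      simp [survEvent, gridEvent]
    simp [kT, measureReal_def, this]
  · have h1 := (ENNReal.tendsto_toReal (measure_ne_top _ _)).comp
      (M.tendsto_measure_gridEvent D i h i)
    refine le_of_tendsto_of_tendsto' (M.tendsto_p_pow hM i (pos_iff_ne_zero.2 hh)) h1 fun m => ?_
    have := ENNReal.toReal_mono (measure_ne_top _ _)
      (M.pow_le_measure_gridEvent D hi (h / 2 ^ m) (2 ^ m))
    rwa [ENNReal.toReal_pow] at this

theorem mul_exp_le_kT [Countable S] (hM : M.HasQMatrix) {i j : S} (hi : i ∉ D) (hj : j ∉ D)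
    (hij : i ≠ j) {h : ℝ≥0} (hh : 0 < h) :
    h * M.q i j * (Real.exp (M.q i i * h) * Real.exp (M.q j j * h)) ≤ M.kT D h i j := by
  have h1 := (ENNReal.tendsto_toReal (measure_ne_top _ _)).comp
    (M.tendsto_measure_gridEvent D i h j)
  have h0 : Tendsto (fun m : ℕ => (h : ℝ) / 2 ^ m) atTop (𝓝[>] 0) := by
    refine tendsto_nhdsWithin_iff.2 ⟨?_, Eventually.of_forall fun m => ?_⟩
    · have : Tendsto (fun m : ℕ => (h : ℝ) * (1 / 2) ^ m) atTop (𝓝 (h * 0)) :=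
        (tendsto_pow_atTop_nhds_zero_of_lt_one (by norm_num) (by norm_num)).const_mul _
      rw [mul_zero] at this
      exact this.congr fun m => by rw [div_pow, one_pow, mul_one_div]
    · have : (0 : ℝ) < h := hh
      exact div_pos this (by positivity)
  have h2 := ((((M.tendsto_p_div hM hij).comp h0).const_mul (h : ℝ))).mul
    ((M.tendsto_p_pow hM i hh).mul (M.tendsto_p_pow hM j hh))
  refine le_of_tendsto_of_tendsto' h2 h1 fun m => ?_
  have := ENNReal.toReal_mono (measure_ne_top _ _)
      (M.mul_pow_le_measure_gridEvent D hi hj hij (h / 2 ^ m) (2 ^ m))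
  simp only [ENNReal.toReal_mul, ENNReal.toReal_pow, ENNReal.toReal_natCast] at this
  refine le_trans (le_of_eq ?_) this
  have e : ((h : ℝ) / 2 ^ m).toNNReal = h / 2 ^ m := by
    rw [← NNReal.coe_ofNat, ← NNReal.coe_pow, ← NNReal.coe_div, Real.toNNReal_coe]
  have hne : (h : ℝ) ≠ 0 := (NNReal.coe_pos.2 hh).ne'
  simp only [Function.comp, e, p, measureReal_def, Nat.cast_pow,
    Nat.cast_ofNat]
  congr 1
  field_simp

/-- Killing does not alter the rates inside `E`: squeeze between `mul_exp_le_kT` and `p_ij`. -/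
theorem tendsto_kT_div [Countable S] (hM : M.HasQMatrix) {i j : S} (hi : i ∉ D) (hj : j ∉ D)
    (hij : i ≠ j) :
    Tendsto (fun h : ℝ => M.kT D h.toNNReal i j / h) (𝓝[>] 0) (𝓝 (M.q i j)) := by
  have h1 : Tendsto (fun h : ℝ => M.q i j * (Real.exp (M.q i i * h) * Real.exp (M.q j j * h)))
      (𝓝[>] 0) (𝓝 (M.q i j)) := by
    have : Continuous fun h : ℝ =>
      M.q i j * (Real.exp (M.q i i * h) * Real.exp (M.q j j * h)) := by fun_prop
    have := this.tendsto 0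
    simp only [mul_zero, Real.exp_zero, mul_one] at this
    exact this.mono_left nhdsWithin_le_nhds
  refine tendsto_of_tendsto_of_tendsto_of_le_of_le' h1 (M.tendsto_p_div hM hij) ?_ ?_
  · filter_upwards [self_mem_nhdsWithin] with h hh
    have hh : 0 < h := hh
    rw [le_div_iff₀ hh]
    have := M.mul_exp_le_kT hM hi hj hij (Real.toNNReal_pos.2 hh)
    rw [Real.coe_toNNReal _ hh.le] at this
    linarith
  · filter_upwards [self_mem_nhdsWithin] with h hh
    exact div_le_div_of_nonneg_right (M.kT_le_p _ _ _) (le_of_lt hh)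

theorem tendsto_kT_self_div [Countable S] (hM : M.HasQMatrix) {i : S} (hi : i ∉ D) :
    Tendsto (fun h : ℝ => (M.kT D h.toNNReal i i - 1) / h) (𝓝[>] 0) (𝓝 (M.q i i)) := by
  have h1 : Tendsto (fun h : ℝ => (Real.exp (M.q i i * h) - 1) / h) (𝓝[>] 0)
      (𝓝 (M.q i i)) := by
    have : HasDerivAt (fun h : ℝ => Real.exp (M.q i i * h)) (M.q i i) 0 := by
      simpa using ((hasDerivAt_id (0 : ℝ)).const_mul (M.q i i)).exp
    have := (hasDerivWithinAt_iff_tendsto_slope' (by simp)).1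
      (this.hasDerivWithinAt (s := Ioi 0))
    exact this.congr fun h => by simp [slope_def_field]
  refine tendsto_of_tendsto_of_tendsto_of_le_of_le' h1 (M.tendsto_p_self_div hM i) ?_ ?_
  · filter_upwards [self_mem_nhdsWithin] with h hh
    have hh : 0 < h := hh
    have := M.exp_le_kT_self hM hi h.toNNReal
    rw [Real.coe_toNNReal _ hh.le] at this
    exact div_le_div_of_nonneg_right (by linarith) hh.le
  · filter_upwards [self_mem_nhdsWithin] with h hh
    exact div_le_div_of_nonneg_right (sub_le_sub_right (M.kT_le_p _ _ _) _) (le_of_lt hh)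

/-! ### The backward equation and differentiability. -/

section Backward

variable [Countable S] {u : ℝ≥0 → S → ℝ}

open Classical in
/-- The entries of the `q`-matrix of the killed chain in `E = S \ D`, extended by zero. -/
noncomputable def qE (M : CTMarkovChain S Ω) (D : Set S) (i k : S) : ℝ :=
  if k ∈ D then 0 else M.q i k

/-- The increment is the off-diagonal sum minus `(1 - kT_ii) * u`. Both lie in `[0, 1 - kT_ii]`, and
`1 - kT_ii ≤ 1 - exp (q_ii h) ≤ -q_ii h`. -/
theorem lipschitzWith_of_hasSum_kT (hM : M.HasQMatrix) (hu0 : ∀ t i, 0 ≤ u t i)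
    (hu1 : ∀ t i, u t i ≤ 1) {i : S} (hi : i ∉ D)
    (hu : ∀ h t, HasSum (fun k => M.kT D h i k * u t k) (u (t + h) i)) :
    LipschitzWith (-M.q i i).toNNReal fun t => u t i := by
  classical
  have key : ∀ t h, |u (t + h) i - u t i| ≤ (-M.q i i).toNNReal * h := by
    intro t h
    have h1 := hasSum_ite_sub_hasSum (hu h t) i
    have h2 := hasSum_ite_sub_hasSum (M.hasSum_kT (D := D) h i) i
    have h3 : 0 ≤ u (t + h) i - M.kT D h i i * u t i := h1.nonneg fun k => by
      split_ifs
      exacts [le_rfl, mul_nonneg (M.kT_nonneg _ _ _) (hu0 _ _)]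
    have h4 : u (t + h) i - M.kT D h i i * u t i ≤ M.sT D h i - M.kT D h i i :=
      hasSum_le (fun k => by
        split_ifs
        exacts [le_rfl, mul_le_of_le_one_right (M.kT_nonneg _ _ _) (hu1 _ _)]) h1 h2
    have h5 := M.sT_le_one (D := D) h i
    have h6 : 1 - M.kT D h i i ≤ (-M.q i i).toNNReal * h := by
      have h7 := M.exp_le_kT_self hM hi h
      have h8 := Real.add_one_le_exp (M.q i i * h)
      have h9 := mul_le_mul_of_nonneg_right (Real.le_coe_toNNReal (-M.q i i)) h.coe_nonneg
      linarith
    have h10 := M.kT_le_one (D := D) h i i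
    have h11 : (1 - M.kT D h i i) * u t i ≤ (1 - M.kT D h i i) * 1 :=
      mul_le_mul_of_nonneg_left (hu1 _ _) (by linarith)
    have h12 : 0 ≤ (1 - M.kT D h i i) * u t i := mul_nonneg (by linarith) (hu0 _ _)
    rw [abs_le]
    constructor <;> linarith
  refine LipschitzWith.of_dist_le_mul fun s t => ?_
  wlog hst : t ≤ s generalizing s t
  · rw [dist_comm, dist_comm s]
    exact this t s (le_of_not_ge hst)
  have := key t (s - t)
  rw [add_tsub_cancel_of_le hst] at this
  rw [Real.dist_eq, NNReal.dist_eq, abs_of_nonneg (sub_nonneg.2 (NNReal.coe_le_coe.2 hst)),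
    ← NNReal.coe_sub hst]
  exact this

theorem tendsto_slope_of_hasSum_kT (hM : M.Conservative) (hu0 : ∀ t i, 0 ≤ u t i)
    (hu1 : ∀ t i, u t i ≤ 1) {i : S} (hi : i ∉ D)
    (hu : ∀ h t, HasSum (fun k => M.kT D h i k * u t k) (u (t + h) i)) (t : ℝ≥0) :
    Tendsto (fun h : ℝ => (u (t + h.toNNReal) i - u t i) / h) (𝓝[>] 0)
      (𝓝 (∑' k, M.qE D i k * u t k)) := by
  classical
  have hB := hasSum_ite_sub_hasSum (hM.2 i) i
  have hb := fun h : ℝ => (hasSum_ite_sub_hasSum (M.hasSum_p h.toNNReal i) i).div_const h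
  have ha := fun h : ℝ => (hasSum_ite_sub_hasSum (hu h.toNNReal t) i).div_const h
  have h1 := tendsto_tsum_of_le_of_tendsto_tsum (l := 𝓝[>] (0 : ℝ))
    (a := fun h k => (if k = i then 0 else M.kT D h.toNNReal i k * u t k) / h)
    (b := fun h k => (if k = i then 0 else M.p h.toNNReal i k) / h)
    (A := fun k => if k = i then 0 else M.qE D i k * u t k)
    (B := fun k => if k = i then 0 else M.q i k)
    (by
      filter_upwards [self_mem_nhdsWithin] with h hh k
      refine div_nonneg ?_ (le_of_lt hh)
      split_ifs
      exacts [le_rfl, mul_nonneg (M.kT_nonneg _ _ _) (hu0 _ _)])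
    (by
      filter_upwards [self_mem_nhdsWithin] with h hh k
      refine div_le_div_of_nonneg_right ?_ (le_of_lt hh)
      split_ifs
      exacts [le_rfl, (mul_le_of_le_one_right (M.kT_nonneg _ _ _) (hu1 _ _)).trans
        (M.kT_le_p _ _ _)])
    (Eventually.of_forall fun h => (hb h).summable)
    (by
      intro k
      by_cases hk : k = i
      · simp [hk]
      by_cases hkD : k ∈ D
      · simp [hk, hkD, qE, M.kT_of_mem hkD]
      · simp only [hk, if_false, qE, hkD]
        refine ((M.tendsto_kT_div hM.1 hi hkD (Ne.symm hk)).mul_const (u t k)).congr fun h => ?_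
        ring)
    (by
      intro k
      by_cases hk : k = i
      · simp [hk]
      · simpa [hk] using M.tendsto_p_div hM.1 (Ne.symm hk))
    hB.summable
    (by
      -- Conservativity enters here: the dominating sums `(1 - p_ii) / h` tend to `-q_ii`, which is
      -- exactly the sum of the off-diagonal rates.
      simp_rw [(hb _).tsum_eq]
      rw [hB.tsum_eq, zero_sub]
      refine (M.tendsto_p_self_div hM.1 i).neg.congr fun h => ?_
      ring)
  have hqs : Summable fun k => M.qE D i k * u t k := by
    refine Summable.of_norm_bounded (hM.2 i).summable.abs fun k => ?_
    rw [norm_mul, Real.norm_eq_abs, Real.norm_eq_abs, abs_of_nonneg (hu0 _ _)]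
    refine (mul_le_of_le_one_right (abs_nonneg _) (hu1 _ _)).trans ?_
    rw [qE]
    split_ifs
    · simp
    · exact le_rfl
  have h2 := hasSum_ite_sub_hasSum hqs.hasSum i
  rw [h2.tsum_eq] at h1
  have h3 := h1.add ((M.tendsto_kT_self_div hM.1 hi).mul_const (u t i))
  rw [qE, if_neg hi, sub_add_cancel] at h3
  refine h3.congr fun h => ?_
  rw [(ha h).tsum_eq]
  ring

/-- The backward equation: a bounded solution of `u (t + h) = kT h * u t` is differentiable. -/
theorem differentiableAt_of_hasSum_kT (hM : M.Conservative) (hu0 : ∀ t i, 0 ≤ u t i)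
    (hu1 : ∀ t i, u t i ≤ 1)
    (hu : ∀ i, i ∉ D → ∀ h t, HasSum (fun k => M.kT D h i k * u t k) (u (t + h) i))
    {i : S} (hi : i ∉ D) {t : ℝ} (ht : 0 < t) :
    DifferentiableAt ℝ (fun s : ℝ => u s.toNNReal i) t := by
  have hc : ∀ k, k ∉ D → Continuous fun s : ℝ => u s.toNNReal k := fun k hk =>
    (M.lipschitzWith_of_hasSum_kT hM.1 hu0 hu1 hk (hu k hk)).continuous.comp
      continuous_real_toNNReal
  -- The candidate derivative; it is continuous by the Weierstrass test with majorant `|q_ik|`.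
  set w : ℝ → ℝ := fun s => ∑' k, M.qE D i k * u s.toNNReal k with hw
  have hwc : Continuous w := by
    refine continuous_tsum (u := fun k => |M.q i k|) (fun k => ?_) (hM.2 i).summable.abs
      fun k s => ?_
    · by_cases hk : k ∈ D
      · simpa [qE, hk] using continuous_const
      · exact continuous_const.mul (hc k hk)
    · rw [norm_mul, Real.norm_eq_abs, Real.norm_eq_abs, abs_of_nonneg (hu0 _ _)]
      refine (mul_le_of_le_one_right (abs_nonneg _) (hu1 _ _)).trans ?_
      rw [qE]
      split_ifs
      · simp
      · exact le_rfl
  have hr : ∀ x, 0 ≤ x → HasDerivWithinAt (fun s : ℝ => u s.toNNReal i) (w x) (Ioi x) x := by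
    intro x hx
    rw [hasDerivWithinAt_iff_tendsto_slope' (by simp)]
    have h1 : Tendsto (fun y => y - x) (𝓝[>] x) (𝓝[>] 0) := by
      refine tendsto_nhdsWithin_iff.2 ⟨?_, ?_⟩
      · have : Tendsto (fun y => y - x) (𝓝 x) (𝓝 (x - x)) :=
          (continuous_id.sub continuous_const).tendsto x
        rw [sub_self] at this
        exact this.mono_left nhdsWithin_le_nhds
      · filter_upwards [self_mem_nhdsWithin] with y hy using mem_Ioi.2 (sub_pos.2 (mem_Ioi.1 hy))
    refine ((M.tendsto_slope_of_hasSum_kT hM hu0 hu1 hi (hu i hi) x.toNNReal).comp h1).congr' ?_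
    filter_upwards [self_mem_nhdsWithin] with y hy
    have hy : x < y := hy
    rw [Function.comp, slope_def_field, ← Real.toNNReal_add hx (sub_nonneg.2 hy.le),
      add_sub_cancel]
  -- A continuous function with a continuous right derivative is its integral, which upgrades the
  -- right derivative to a two-sided one.
  have hI : ∀ s, 0 ≤ s → u s.toNNReal i = u 0 i + ∫ x in (0 : ℝ)..s, w x := by
    intro s hs
    have := intervalIntegral.integral_eq_sub_of_hasDeriv_right (a := 0) (b := s)
      (f := fun s : ℝ => u s.toNNReal i) (hc i hi).continuousOn
      (fun x hx => hr x (by rw [min_eq_left hs] at hx; exact hx.1.le))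
      (hwc.intervalIntegrable _ _)
    rw [this]
    simp
  have hd : HasDerivAt (fun s : ℝ => u 0 i + ∫ x in (0 : ℝ)..s, w x) (w t) t :=
    (intervalIntegral.integral_hasDerivAt_right (hwc.intervalIntegrable _ _)
      (hwc.stronglyMeasurableAtFilter _ _) hwc.continuousAt).const_add _
  refine (hd.congr_of_eventuallyEq ?_).differentiableAt
  filter_upwards [lt_mem_nhds ht] with s hs using hI s hs.le

theorem continuous_of_hasSum_kT (hM : M.HasQMatrix) (hu0 : ∀ t i, 0 ≤ u t i)
    (hu1 : ∀ t i, u t i ≤ 1) {i : S} (hi : i ∉ D)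
    (hu : ∀ h t, HasSum (fun k => M.kT D h i k * u t k) (u (t + h) i)) :
    Continuous fun s : ℝ => u s.toNNReal i :=
  (M.lipschitzWith_of_hasSum_kT hM hu0 hu1 hi hu).continuous.comp continuous_real_toNNReal

end Backward

end CTMarkovChain

theorem HasSum.option {β : Type*} {f : Option β → ℝ} {x : ℝ}
    (h : HasSum (fun i => f (some i)) x) : HasSum f (f none + x) := by
  classical
  have h1 : HasSum (fun i : Option β => if i = none then 0 else f i) x := by
    refine ((Option.some_injective β).hasSum_iff ?_).1 (by simpa [Function.comp_def] using h)
    rintro (_ | i) hi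
    · rfl
    · exact absurd ⟨i, rfl⟩ hi
  refine ((hasSum_ite_eq none (f none)).add h1).of_forall_eq ?_
  rintro (_ | i) <;> simp

/-! ### The killed transition matrix including the cemetery. -/

namespace CTMarkovChain

variable {S Ω : Type*} [MeasurableSpace Ω] (M : CTMarkovChain S Ω) {D : Set S}

theorem killed_eq_some_iff (t : ℝ≥0) (ω : Ω) (j : ↥Dᶜ) :
    M.killed D t ω = some j ↔ ω ∈ M.survEvent D 0 t j := by
  rw [survEvent_zero_eq, killed]
  split_ifs with h <;> simp [h, Subtype.ext_iff]

theorem killed_eq_none_iff (t : ℝ≥0) (ω : Ω) :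
    M.killed D t ω = none ↔ ¬ (t : ℝ≥0∞) < M.T D ω := by
  rw [killed]
  split_ifs with h <;> simp [h]

theorem pT_some_some (t : ℝ≥0) (i j : ↥Dᶜ) : M.pT D t (some i) (some j) = M.kT D t i j := by
  simp only [pT, kT, killed_eq_some_iff, ofPred_mem_eq]

theorem pT_some_none [Countable S] (t : ℝ≥0) (i : ↥Dᶜ) :
    M.pT D t (some i) none = 1 - M.sT D t i := by
  simp only [pT, sT, killed_eq_none_iff]
  exact probReal_compl_eq_one_sub (M.measurableSet_lt_T t)

theorem pT_none_some (t : ℝ≥0) (j : ↥Dᶜ) : M.pT D t none (some j) = 0 := by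
  simp [pT]

theorem pT_none_none (t : ℝ≥0) : M.pT D t none none = 1 := by
  simp [pT]

theorem pT_nonneg (t : ℝ≥0) (i j : Option ↥Dᶜ) : 0 ≤ M.pT D t i j := by
  rcases i with _ | i
  · simp only [pT]
    split_ifs <;> norm_num
  · exact measureReal_nonneg

theorem hasSum_compl_kT {t : ℝ≥0} {i : S} {f : S → ℝ} {x : ℝ}
    (h : HasSum (fun k => M.kT D t i k * f k) x) :
    HasSum (fun k : ↥Dᶜ => M.kT D t i k * f k) x := by
  have hs : Function.support (fun k => M.kT D t i k * f k) ⊆ Dᶜ := fun k hk hkD =>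
    hk (by simp [M.kT_of_mem hkD])
  exact (hasSum_subtype_iff_of_support_subset hs).2 h

theorem hasSum_pT_add [Countable S] (t s : ℝ≥0) (i j : Option ↥Dᶜ) :
    HasSum (fun k => M.pT D t i k * M.pT D s k j) (M.pT D (t + s) i j) := by
  rcases i with _ | i
  · have h : HasSum (fun k : ↥Dᶜ => M.pT D t none (some k) * M.pT D s (some k) j) 0 :=
      hasSum_zero.of_forall_eq fun k => by rw [pT_none_some, zero_mul]
    have h1 := h.option (f := fun k => M.pT D t none k * M.pT D s k j)
    rw [pT_none_none, one_mul, add_zero] at h1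
    exact h1
  rcases j with _ | j
  · have h1 := M.hasSum_compl_kT (D := D) (f := fun _ => 1)
      ((M.hasSum_kT t i).of_forall_eq fun k => (mul_one _).symm)
    have h := (h1.sub (M.hasSum_compl_kT (M.hasSum_sT_add (D := D) t s i)))
    -- The mass killed between `t` and `t + s`; the remaining `Δ` term is the mass killed by time
    -- `t`.
    have h2 : HasSum (fun k : ↥Dᶜ => M.pT D t (some i) (some k) * M.pT D s (some k) none)
        (M.sT D t i - M.sT D (t + s) i) := h.of_forall_eq fun k => by
      rw [pT_some_some, pT_some_none]; ring
    have h3 := h2.option (f := fun k => M.pT D t (some i) k * M.pT D s k none)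
    rw [pT_none_none, pT_some_none, mul_one, sub_add_sub_cancel] at h3
    rwa [pT_some_none]
  · have h2 : HasSum (fun k : ↥Dᶜ => M.pT D t (some i) (some k) * M.pT D s (some k) (some j))
        (M.kT D (t + s) i j) := (M.hasSum_compl_kT (M.hasSum_kT_add t s i j)).of_forall_eq
      fun k => by rw [pT_some_some, pT_some_some]
    have h3 := h2.option (f := fun k => M.pT D t (some i) k * M.pT D s k (some j))
    rw [pT_none_some, mul_zero, zero_add] at h3
    rwa [pT_some_some]

theorem differentiableAt_pT [Countable S] (hM : M.Conservative) (i j : Option ↥Dᶜ) {t : ℝ}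
    (ht : 0 < t) : DifferentiableAt ℝ (fun s : ℝ => M.pT D s.toNNReal i j) t := by
  rcases i with _ | i
  · exact differentiableAt_const _
  rcases j with _ | j
  · simp_rw [pT_some_none]
    exact (differentiableAt_const _).sub (M.differentiableAt_of_hasSum_kT hM M.sT_nonneg
      M.sT_le_one (fun i _ h t => by rw [add_comm]; exact M.hasSum_sT_add h t i) i.2 ht)
  · simp_rw [pT_some_some]
    exact M.differentiableAt_of_hasSum_kT (u := fun t i => M.kT D t i j) hM
      (fun t i => M.kT_nonneg t i j) (fun t i => M.kT_le_one t i j)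
      (fun i _ h t => by rw [add_comm]; exact M.hasSum_kT_add h t i j) i.2 ht

theorem monotoneOn_pT_none [Countable S] (i : Option ↥Dᶜ) :
    MonotoneOn (fun t : ℝ => M.pT D t.toNNReal i none) (Ioi 0) := by
  intro x _ y _ hxy
  rcases i with _ | i
  · simp [pT_none_none]
  · simp only [pT_some_none]
    refine sub_le_sub_left (measureReal_mono fun ω hω => ?_) _
    exact (ENNReal.coe_le_coe.2 (Real.toNNReal_le_toNNReal hxy)).trans_lt hω

/-- Being in `j` at time `x` and surviving with return to `j` after `y - x` costs at most a factor
`exp (q_jj (y - x))`, uniformly in `i`. -/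
theorem monotoneOn_exp_mul_pT_some [Countable S] (hM : M.HasQMatrix) (i : Option ↥Dᶜ)
    (j : ↥Dᶜ) :
    MonotoneOn (fun t : ℝ => Real.exp (-M.q j j * t) * M.pT D t.toNNReal i (some j))
      (Ioi 0) := by
  intro x hx y _ hxy
  have hx : 0 < x := hx
  rcases i with _ | i
  · simp [pT_none_some]
  · simp only [pT_some_some]
    have h1 : M.kT D x.toNNReal i j * M.kT D (y - x).toNNReal j j ≤ M.kT D y.toNNReal i j := by
      have := M.hasSum_kT_add (D := D) x.toNNReal (y - x).toNNReal i j
      rw [← Real.toNNReal_add hx.le (sub_nonneg.2 hxy), add_sub_cancel] at this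
      exact le_hasSum this (j : S) fun k _ => mul_nonneg (M.kT_nonneg _ _ _) (M.kT_nonneg _ _ _)
    have h2 := M.exp_le_kT_self hM j.2 (y - x).toNNReal
    rw [Real.coe_toNNReal _ (sub_nonneg.2 hxy)] at h2
    have h3 : Real.exp (-M.q j j * x) = Real.exp (-M.q j j * y) * Real.exp (M.q j j * (y - x)) := by
      rw [← Real.exp_add]
      ring_nf
    rw [h3, mul_assoc]
    refine mul_le_mul_of_nonneg_left (le_trans ?_ h1) (Real.exp_pos _).le
    rw [mul_comm]
    exact mul_le_mul_of_nonneg_left h2 (M.kT_nonneg _ _ _)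

/-! ### Consequences of quasi-stationarity. -/

section QuasiStationary

variable {μ : PMF (Option ↥Dᶜ)}

/-- The probability `ℙ_μ(t < T)`. -/
noncomputable def surv (M : CTMarkovChain S Ω) (μ : PMF (Option ↥Dᶜ)) (t : ℝ≥0) : ℝ≥0∞ :=
  M.Pμ D μ {ω | (t : ℝ≥0∞) < M.T D ω}

theorem Pμ_apply {A : Set Ω} (hA : MeasurableSet A) :
    M.Pμ D μ A = ∑' i : ↥Dᶜ, μ (some i) * M.P i A := by
  simp [Pμ, Measure.sum_apply _ hA]

theorem tsum_some (h : μ none = 0) : ∑' i, μ (some i) = 1 := by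
  rw [← μ.tsum_coe, (Option.some_injective _).tsum_eq (f := μ)]
  rintro (_ | i) hi
  · exact absurd h hi
  · exact ⟨i, rfl⟩

theorem hasSum_toReal_some (h : μ none = 0) :
    HasSum (fun i : ↥Dᶜ => (μ (some i)).toReal) 1 := by
  simpa using hasSum_toReal_of_tsum_eq (tsum_some h).symm ENNReal.one_ne_top

variable [Countable S]

theorem surv_ne_top (h : μ none = 0) (t : ℝ≥0) : M.surv μ t ≠ ∞ := by
  rw [surv, Pμ_apply M (M.measurableSet_lt_T t)]
  refine ne_top_of_le_ne_top ENNReal.one_ne_top ?_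
  rw [← tsum_some h]
  exact ENNReal.tsum_le_tsum fun i => mul_le_of_le_one_right' prob_le_one

/-- Conditioning on a null event gives the zero measure by convention, which cannot have the masses
of `μ`. -/
theorem surv_ne_zero (h : M.IsQuasiStationary D μ) (t : ℝ≥0) : M.surv μ t ≠ 0 := by
  intro h0
  obtain ⟨i, hi⟩ := μ.support_nonempty
  refine hi ?_
  have h1 := h.2 t i
  rw [ProbabilityTheory.cond_apply (M.measurableSet_lt_T t)] at h1
  rw [← h1, measure_mono_null inter_subset_left h0, mul_zero]

theorem tsum_mul_survEvent (h : M.IsQuasiStationary D μ) (t : ℝ≥0) (j : ↥Dᶜ) :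
    ∑' i : ↥Dᶜ, μ (some i) * M.P i (M.survEvent D 0 t j) = M.surv μ t * μ (some j) := by
  have h1 := h.2 t (some j)
  rw [ProbabilityTheory.cond_apply (M.measurableSet_lt_T t)] at h1
  have h2 : {ω | (t : ℝ≥0∞) < M.T D ω} ∩ {ω | M.killed D t ω = some j} =
      M.survEvent D 0 t j := by
    simp only [killed_eq_some_iff, ofPred_mem_eq]
    rw [survEvent_zero_eq]
    exact inter_eq_right.2 fun ω hω => hω.1
  rw [h2] at h1
  rw [← Pμ_apply M (M.measurableSet_survEvent_zero t j), ← h1, ← mul_assoc]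
  change _ = M.surv μ t * (M.surv μ t)⁻¹ * _
  rw [ENNReal.mul_inv_cancel (M.surv_ne_zero h t) (M.surv_ne_top h.1 t), one_mul]

/-- Given survival up to `t`, the chain restarts from the law `μ`. -/
theorem surv_add (h : M.IsQuasiStationary D μ) (t s : ℝ≥0) :
    M.surv μ (t + s) = M.surv μ t * M.surv μ s := by
  have h1 : ∀ i : S, M.P i {ω | ((t + s : ℝ≥0) : ℝ≥0∞) < M.T D ω} =
      ∑' k : ↥Dᶜ, M.P i (M.survEvent D 0 t k) * M.P k {ω | (s : ℝ≥0∞) < M.T D ω} := by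
    intro i
    rw [tsum_subtype_eq_of_support_subset
      (f := fun k => M.P i (M.survEvent D 0 t k) * M.P k {ω | (s : ℝ≥0∞) < M.T D ω})]
    · simp_rw [measure_lt_T, measure_survEvent_add, ← ENNReal.tsum_mul_left]
      exact ENNReal.tsum_comm
    · intro k hk hkD
      exact hk (by simp [M.survEvent_of_mem hkD])
  calc M.surv μ (t + s)
      = ∑' i : ↥Dᶜ, ∑' k : ↥Dᶜ, μ (some i) * M.P i (M.survEvent D 0 t k) *
          M.P k {ω | (s : ℝ≥0∞) < M.T D ω} := by
        rw [surv, Pμ_apply M (M.measurableSet_lt_T _)]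
        simp_rw [h1, ← ENNReal.tsum_mul_left, mul_assoc]
    _ = ∑' k : ↥Dᶜ, M.surv μ t * (μ (some k) * M.P k {ω | (s : ℝ≥0∞) < M.T D ω}) := by
        rw [ENNReal.tsum_comm]
        simp_rw [ENNReal.tsum_mul_right, M.tsum_mul_survEvent h t, mul_assoc]
    _ = _ := by
        rw [ENNReal.tsum_mul_left, ← Pμ_apply M (M.measurableSet_lt_T s)]
        rfl

theorem hasSum_mul_sT (h : μ none = 0) (t : ℝ≥0) :
    HasSum (fun i : ↥Dᶜ => (μ (some i)).toReal * M.sT D t i) (M.surv μ t).toReal := by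
  have h1 := M.surv_ne_top h t
  have h2 : M.surv μ t = ∑' i : ↥Dᶜ, μ (some i) * M.P i {ω | (t : ℝ≥0∞) < M.T D ω} :=
    Pμ_apply M (M.measurableSet_lt_T t)
  exact (hasSum_toReal_of_tsum_eq h2 h1).of_forall_eq fun k => by rw [ENNReal.toReal_mul]; rfl

theorem hasSum_mul_kT (h : M.IsQuasiStationary D μ) (t : ℝ≥0) (j : ↥Dᶜ) :
    HasSum (fun i : ↥Dᶜ => (μ (some i)).toReal * M.kT D t i j)
      ((M.surv μ t).toReal * (μ (some j)).toReal) := by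
  rw [← ENNReal.toReal_mul]
  exact (hasSum_toReal_of_tsum_eq (M.tsum_mul_survEvent h t j).symm
    (ENNReal.mul_ne_top (M.surv_ne_top h.1 t) (μ.apply_ne_top _))).of_forall_eq fun k => by
      rw [ENNReal.toReal_mul]; rfl

theorem hasSum_mul_pT_some (h : M.IsQuasiStationary D μ) (t : ℝ≥0) (j : ↥Dᶜ) :
    HasSum (fun i => (μ i).toReal * M.pT D t i (some j))
      ((M.surv μ t).toReal * (μ (some j)).toReal) := by
  have h1 : HasSum (fun i : ↥Dᶜ => (μ (some i)).toReal * M.pT D t (some i) (some j))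
    ((M.surv μ t).toReal * (μ (some j)).toReal) :=
    (M.hasSum_mul_kT h t j).of_forall_eq fun i => by rw [pT_some_some]
  simpa [h.1] using h1.option (f := fun i => (μ i).toReal * M.pT D t i (some j))

theorem hasSum_mul_pT_none (h : μ none = 0) (t : ℝ≥0) :
    HasSum (fun i => (μ i).toReal * M.pT D t i none) (1 - (M.surv μ t).toReal) := by
  have h1 : HasSum (fun i : ↥Dᶜ => (μ (some i)).toReal * M.pT D t (some i) none)
    (1 - (M.surv μ t).toReal) :=
    ((hasSum_toReal_some h).sub (M.hasSum_mul_sT h t)).of_forall_eq fun i => by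
      rw [pT_some_none]; ring
  simpa [h] using h1.option (f := fun i => (μ i).toReal * M.pT D t i none)

theorem continuous_surv (hM : M.HasQMatrix) (h : μ none = 0) :
    Continuous fun s : ℝ => (M.surv μ s.toNNReal).toReal := by
  simp_rw [← (M.hasSum_mul_sT h _).tsum_eq]
  refine continuous_tsum (fun i => continuous_const.mul ?_) (hasSum_toReal_some h).summable
    fun i s => ?_
  · exact M.continuous_of_hasSum_kT (D := D) hM M.sT_nonneg M.sT_le_one i.2
      fun h t => by rw [add_comm]; exact M.hasSum_sT_add h t i
  · rw [Real.norm_of_nonneg (mul_nonneg ENNReal.toReal_nonneg (M.sT_nonneg _ _))]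
    exact mul_le_of_le_one_right ENNReal.toReal_nonneg (M.sT_le_one _ _)

theorem exists_hasDerivAt_surv (hM : M.HasQMatrix) (h : M.IsQuasiStationary D μ) :
    ∃ c : ℝ, ∀ t : ℝ, 0 < t → HasDerivAt (fun s : ℝ => (M.surv μ s.toNNReal).toReal)
      (c * (M.surv μ t.toNNReal).toReal) t :=
  exists_hasDerivAt_of_mul (M.continuous_surv hM h.1)
    (fun t => ENNReal.toReal_pos (M.surv_ne_zero h _) (M.surv_ne_top h.1 _))
    fun t s ht hs => by rw [Real.toNNReal_add ht hs, M.surv_add h, ENNReal.toReal_mul]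

end QuasiStationary

end CTMarkovChain

/-! ### Conclusion. -/

theorem mainTheorem8 {S Ω : Type*} [Countable S] [MeasurableSpace Ω] (M : CTMarkovChain S Ω)
    (hirr : M.Irreducible) (hcons : M.Conservative) (hexpl : M.NonExplosive)
    (D : Set S) (μ : PMF (Option ↥Dᶜ)) (hμ : M.IsQuasiStationary D μ) :
    M.DiffCondition D μ := by
  obtain ⟨c, hc⟩ := M.exists_hasDerivAt_surv hcons.1 hμ
  have hadd : ∀ t s : ℝ, 0 < t → 0 < s → (M.surv μ (t + s).toNNReal).toReal =
      (M.surv μ t.toNNReal).toReal * (M.surv μ s.toNNReal).toReal := fun t s ht hs => by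
    rw [Real.toNNReal_add ht.le hs.le, M.surv_add hμ, ENNReal.toReal_mul]
  have hCK : ∀ j, ∀ t s : ℝ, 0 < t → 0 < s → ∀ i, HasSum
      (fun k => M.pT D t.toNNReal i k * M.pT D s.toNNReal k j) (M.pT D (t + s).toNNReal i j) :=
    fun j t s ht hs i => by
      rw [Real.toNNReal_add ht.le hs.le]
      exact M.hasSum_pT_add _ _ i j
  -- There is equality on `E`. At `Δ` only an inequality is available: `μ` does not charge `Δ`,
  -- whereas `μ P^T(t)` has mass `1 - a t` there.
  have hμK : ∀ t : ℝ, 0 < t → ∀ k, Summable (fun i => (μ i).toReal * M.pT D t.toNNReal i k) ∧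
      (M.surv μ t.toNNReal).toReal * (μ k).toReal ≤
        ∑' i, (μ i).toReal * M.pT D t.toNNReal i k := by
    rintro t - (_ | k)
    · refine ⟨(M.hasSum_mul_pT_none hμ.1 _).summable, ?_⟩
      rw [hμ.1, ENNReal.toReal_zero, mul_zero]
      exact tsum_nonneg fun i => mul_nonneg ENNReal.toReal_nonneg (M.pT_nonneg _ _ _)
    · have := M.hasSum_mul_pT_some hμ t.toNNReal k
      exact ⟨this.summable, this.tsum_eq.ge⟩
  have hd : ∀ j i, ∀ t : ℝ, 0 < t → HasDerivAt (fun s : ℝ => M.pT D s.toNNReal i j)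
      (deriv (fun s : ℝ => M.pT D s.toNNReal i j) t) t :=
    fun j i t ht => (M.differentiableAt_pT hcons i j ht).hasDerivAt
  intro t ht j
  refine ⟨fun i => M.differentiableAt_pT hcons i j ht, ?_⟩
  rcases j with _ | j
  · have hm := fun s : ℝ => M.hasSum_mul_pT_none hμ.1 s.toNNReal
    have hm' : ∀ s : ℝ, 0 < s → HasDerivAt (fun s : ℝ => 1 - (M.surv μ s.toNNReal).toReal)
        (-(c * (M.surv μ s.toNNReal).toReal)) s := fun s hs => (hc s hs).const_sub 1
    -- With exponent zero only the derivative of `1 - a` must scale by `a`; the function itself need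
    -- not.
    have h := hasSum_deriv_of_subinvariant (c := 0) (a := fun s => (M.surv μ s.toNNReal).toReal)
      (fun i => ENNReal.toReal_nonneg (a := μ i)) (fun t : ℝ => M.pT_nonneg t.toNNReal)
      (hd none) (fun i => by simpa using M.monotoneOn_pT_none i) (fun s _ => hm s) hm'
      (hCK none) hμK (fun t s ht hs => by simp only [hadd t s ht hs]; ring) ht
    refine ⟨h.summable, ?_⟩
    simp only [CTMarkovChain.μPT, (hm _).tsum_eq, h.tsum_eq]
    exact hm' t ht
  · have hm := fun s : ℝ => M.hasSum_mul_pT_some hμ s.toNNReal j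
    have hm' : ∀ s : ℝ, 0 < s → HasDerivAt
        (fun s : ℝ => (M.surv μ s.toNNReal).toReal * (μ (some j)).toReal)
        (c * (M.surv μ s.toNNReal).toReal * (μ (some j)).toReal) s :=
      fun s hs => (hc s hs).mul_const _
    have h := hasSum_deriv_of_subinvariant (c := -M.q j j)
      (a := fun s => (M.surv μ s.toNNReal).toReal)
      (fun i => ENNReal.toReal_nonneg (a := μ i)) (fun t : ℝ => M.pT_nonneg t.toNNReal)
      (hd (some j)) (fun i => M.monotoneOn_exp_mul_pT_some hcons.1 i j) (fun s _ => hm s) hm'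
      (hCK (some j)) hμK (fun t s ht hs => by simp only [hadd t s ht hs]; ring) ht
    refine ⟨h.summable, ?_⟩
    simp only [CTMarkovChain.μPT, (hm _).tsum_eq, h.tsum_eq]
    exact hm' t ht
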